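/- Let $d,n,m\ge 0$ be integers. Let $\mathcal W=\mathbb R^{2nd}\times\mathbb R_{\ge 0}^{2mn}$ be the space of network weights $(A,B,C,D)$ of type $(d,n,m)$, where $A,B$ are real $n\times d$ matrices and $C,D$ are nonnegative $m\times n$ matrices. Let $\mathbb R^{N}$, $N=dn+2m(d+n)$, be the space of parameters $(\mathfrak u,\mathfrak v,\mathfrak w,\mathfrak s,\mathfrak t)$ of maxout candidates, with $\mathfrak u$ of size $d\times n$, $\mathfrak v,\mathfrak w$ of size $d\times m$, and $\mathfrak s,\mathfrak t$ of size $m\times n$. Let $$\phi:\mathcal W\to\mathbb R^{N},\quad (A,B,C,D)\mapsto(\mathfrak u,\mathfrak v,\mathfrak w,\mathfrak s,\mathfrak t)=\bigl((B-A)^\top,(CA)^\top,(DA)^\top,C,D\bigr).$$ The group $\mathbb R_{>0}^n$ of positive diagonal matrices $\Lambda$ acts by $(A,B,C,D)\mapsto(\Lambda^{-1}A,\Lambda^{-1}B,C\Lambda,D\Lambda)$ and $(\mathfrak u,\mathfrak v,\mathfrak w,\mathfrak s,\mathfrak t)\mapsto(\mathfrak u\Lambda^{-1},\mathfrak v,\mathfrak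 w,\mathfrak s\Lambda,\mathfrak t\Lambda)$; $\phi$ is equivariant and induces $\overline\phi:\mathcal W/\mathbb R_{>0}^n\to\mathbb R^N/\mathbb R_{>0}^n$. The dimension of a semialgebraic set $S$ is the Krull dimension of the ring of polynomial functions on $S$, and the dimension of a subset $F$ of $\mathcal W/\mathbb R_{>0}^n$ is the least dimension of a semialgebraic subset of $\mathcal W$ whose image in the quotient is $F$. Then: 1. The generic fibers of $\phi$ and $\overline\phi$ have the expected dimension $\max(0,dn-2dm)$: there is a polynomial $p$ on $\mathbb R^N$ such that $\{y\in\operatorname{im}\phi: p(y)\ne0\}$ is Zariski dense in $\operatorname{im}\phi$, and for every $y$ in this set both $\phi^{-1}(y)$ and $\overline\phi^{-1}([y])$ have dimension $\max(0,dn-2dm)$. 2. The image of $\phi$ is a semialgebraic set. 3. If $2m\ge n$, then the Zariski closure of the image of $\phi$ is the determinantal variety of all $(\mathfrak u,\mathfrak v,\mathfrak w,\mathfrak s,\mathfrak t)\in\mathbb R^N$ for which the $(n+d)\times 2m$ matrix $\begin{pmatrix}\mathfrak s^\top&\mathfrak t^\top\\ \mathfrak v&\mathfrak w\end{pmatrix}$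 has rank at most $n$. Both this variety and the image of $\phi$ have dimension $2nd+2mn$. 4. If $dn-2dm<0$, then the Zariski closure of the image of $\phi$ is a proper algebraic subvariety of $\mathbb R^N$. 5. If $2m\le n$ (in particular if $2m<n$), then the image of $\phi$ is full-dimensional: it is Zariski dense in $\mathbb R^N$, has dimension $N=dn+2m(d+n)$, and has nonempty interior. -/

import Mathlib

open Matrix MvPolynomial

noncomputable section

namespace Maxout

/-! ### Semialgebraic sets, Zariski closure and dimension -/

/-- Semialgebraic subsets of real affine space: the smallest Boolean algebra of sets that contains
all sets `{x | 0 < p x}` with `p` a real polynomial. -/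
inductive IsSemialgebraic {σ : Type} : Set (σ → ℝ) → Prop
  | pos (p : MvPolynomial σ ℝ) : IsSemialgebraic {x | 0 < eval x p}
  | compl {S : Set (σ → ℝ)} : IsSemialgebraic S → IsSemialgebraic Sᶜ
  | union {S T : Set (σ → ℝ)} : IsSemialgebraic S → IsSemialgebraic T → IsSemialgebraic (S ∪ T)

/-- The Zariski closure of a subset of real affine space. -/
def zariskiClosure {σ : Type} (S : Set (σ → ℝ)) : Set (σ → ℝ) :=
  zeroLocus ℝ (vanishingIdeal ℝ S)

/-- The dimension of a (semialgebraic) subset `S` of real affine space: the Krull dimension of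
the ring of polynomial functions on `S`. The empty set has dimension `⊥`. -/
def semialgDim {σ : Type} (S : Set (σ → ℝ)) : WithBot ℕ∞ :=
  ringKrullDim (MvPolynomial σ ℝ ⧸ vanishingIdeal ℝ S)

/-- The dimension of a set `F` of points of a quotient `q : X → Q` of a subset `X` of real affine
space: the least dimension of a semialgebraic set of representatives of `F` in `X`.
(Semialgebraic maps do not raise dimension, so a semialgebraic set that contains exactly one
representative of every point of `F` attains the minimum.) -/
def quotientDim {σ : Type} {X : Set (σ → ℝ)} {Q : Type} (q : X → Q) (F : Set Q) : WithBot ℕ∞ :=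
  ⨅ (T : Set X) (_ : IsSemialgebraic (Subtype.val '' T)) (_ : q '' T = F),
    semialgDim (Subtype.val '' T)

/-! ### Network weights of type `(d, n, m)` -/

/-- The coordinates of a tuple `(A, B, C, D)` of two `n × d` and two `m × n` matrices. -/
abbrev WeightIdx (d n m : ℕ) : Type :=
  ((Fin n × Fin d) ⊕ (Fin n × Fin d)) ⊕ ((Fin m × Fin n) ⊕ (Fin m × Fin n))

variable {d n m : ℕ}

def weightA (x : WeightIdx d n m → ℝ) : Matrix (Fin n) (Fin d) ℝ :=
  Matrix.of fun i j => x (.inl (.inl (i, j)))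

def weightB (x : WeightIdx d n m → ℝ) : Matrix (Fin n) (Fin d) ℝ :=
  Matrix.of fun i j => x (.inl (.inr (i, j)))

def weightC (x : WeightIdx d n m → ℝ) : Matrix (Fin m) (Fin n) ℝ :=
  Matrix.of fun k i => x (.inr (.inl (k, i)))

def weightD (x : WeightIdx d n m → ℝ) : Matrix (Fin m) (Fin n) ℝ :=
  Matrix.of fun k i => x (.inr (.inr (k, i)))

/-- The space of weights: `A`, `B` arbitrary, `C`, `D` entrywise nonnegative. -/
def weightSpace (d n m : ℕ) : Set (WeightIdx d n m → ℝ) :=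
  {x | (∀ k i, 0 ≤ weightC x k i) ∧ (∀ k i, 0 ≤ weightD x k i)}

/-- The scaling `(A, B, C, D) ↦ (Λ⁻¹ A, Λ⁻¹ B, C Λ, D Λ)` with `Λ = diag l`. -/
def scaleWeights (l : Fin n → ℝ) (x : WeightIdx d n m → ℝ) : WeightIdx d n m → ℝ
  | .inl (.inl (i, j)) => (l i)⁻¹ * weightA x i j
  | .inl (.inr (i, j)) => (l i)⁻¹ * weightB x i j
  | .inr (.inl (k, i)) => weightC x k i * l i
  | .inr (.inr (k, i)) => weightD x k i * l i

/-! ### Parameters of maxout candidates of type `(d, n, m)` -/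

/-- The coordinates of a tuple `(u, (v, w), (s, t))` of a `d × n` matrix, two `d × m` matrices and
two `m × n` matrices. -/
abbrev CandIdx (d n m : ℕ) : Type :=
  (Fin d × Fin n) ⊕ (((Fin d × Fin m) ⊕ (Fin d × Fin m)) ⊕ ((Fin m × Fin n) ⊕ (Fin m × Fin n)))

/-- The direction vectors, as columns. -/
def candU (y : CandIdx d n m → ℝ) : Matrix (Fin d) (Fin n) ℝ :=
  Matrix.of fun j i => y (.inl (j, i))

/-- The first shift vectors, as columns. -/
def candV (y : CandIdx d n m → ℝ) : Matrix (Fin d) (Fin m) ℝ :=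
  Matrix.of fun j k => y (.inr (.inl (.inl (j, k))))

/-- The second shift vectors, as columns. -/
def candW (y : CandIdx d n m → ℝ) : Matrix (Fin d) (Fin m) ℝ :=
  Matrix.of fun j k => y (.inr (.inl (.inr (j, k))))

/-- The first scaling vectors, as rows. -/
def candS (y : CandIdx d n m → ℝ) : Matrix (Fin m) (Fin n) ℝ :=
  Matrix.of fun k i => y (.inr (.inr (.inl (k, i))))

/-- The second scaling vectors, as rows. -/
def candT (y : CandIdx d n m → ℝ) : Matrix (Fin m) (Fin n) ℝ :=
  Matrix.of fun k i => y (.inr (.inr (.inr (k, i))))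

/-- The scaling `(u, v, w, s, t) ↦ (u Λ⁻¹, v, w, s Λ, t Λ)` with `Λ = diag l`. -/
def scaleCand (l : Fin n → ℝ) (y : CandIdx d n m → ℝ) : CandIdx d n m → ℝ
  | .inl (j, i) => candU y j i * (l i)⁻¹
  | .inr (.inl (.inl (j, k))) => candV y j k
  | .inr (.inl (.inr (j, k))) => candW y j k
  | .inr (.inr (.inl (k, i))) => candS y k i * l i
  | .inr (.inr (.inr (k, i))) => candT y k i * l i

/-- The `(n + d) × 2m` matrix with rows of blocks `(sᵀ tᵀ)` and `(v w)`. -/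
def candMatrix (y : CandIdx d n m → ℝ) : Matrix (Fin n ⊕ Fin d) (Fin m ⊕ Fin m) ℝ :=
  Matrix.fromBlocks (candS y)ᵀ (candT y)ᵀ (candV y) (candW y)

/-- The determinantal variety, in the space of all tuples `(u, v, w, s, t)`. -/
def detVariety (d n m : ℕ) : Set (CandIdx d n m → ℝ) :=
  {y | (candMatrix y).rank ≤ n}

/-! ### The map from networks to maxout candidates -/

/-- The map `φ`: `u = (B - A)ᵀ`, `v = (C A)ᵀ`, `w = (D A)ᵀ`, `s = C`, `t = D`. -/
def phi (x : weightSpace d n m) : CandIdx d n m → ℝ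
  | .inl (j, i) => (weightB x.1 - weightA x.1)ᵀ j i
  | .inr (.inl (.inl (j, k))) => (weightC x.1 * weightA x.1)ᵀ j k
  | .inr (.inl (.inr (j, k))) => (weightD x.1 * weightA x.1)ᵀ j k
  | .inr (.inr (.inl (k, i))) => weightC x.1 k i
  | .inr (.inr (.inr (k, i))) => weightD x.1 k i

theorem scaleWeights_one (x : WeightIdx d n m → ℝ) : scaleWeights (fun _ => 1) x = x := by
  funext e
  rcases e with (⟨i, j⟩ | ⟨i, j⟩) | (⟨k, i⟩ | ⟨k, i⟩) <;>
    simp [scaleWeights, weightA, weightB, weightC, weightD]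

theorem scaleWeights_mul (l l' : Fin n → ℝ) (x : WeightIdx d n m → ℝ) :
    scaleWeights l (scaleWeights l' x) = scaleWeights (fun i => l i * l' i) x := by
  funext e
  rcases e with (⟨i, j⟩ | ⟨i, j⟩) | (⟨k, i⟩ | ⟨k, i⟩) <;>
    simp [scaleWeights, weightA, weightB, weightC, weightD] <;> ring

theorem scaleCand_one (y : CandIdx d n m → ℝ) : scaleCand (fun _ => 1) y = y := by
  funext e
  rcases e with ⟨j, i⟩ | ((⟨j, k⟩ | ⟨j, k⟩) | (⟨k, i⟩ | ⟨k, i⟩)) <;>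
    simp [scaleCand, candU, candV, candW, candS, candT]

theorem scaleCand_mul (l l' : Fin n → ℝ) (y : CandIdx d n m → ℝ) :
    scaleCand l (scaleCand l' y) = scaleCand (fun i => l i * l' i) y := by
  funext e
  rcases e with ⟨j, i⟩ | ((⟨j, k⟩ | ⟨j, k⟩) | (⟨k, i⟩ | ⟨k, i⟩)) <;>
    simp [scaleCand, candU, candV, candW, candS, candT] <;> ring

/-- Two weight vectors are equivalent if a positive scaling takes one to the other. -/
def weightSetoid (d n m : ℕ) : Setoid (weightSpace d n m) where
  r x x' := ∃ l : Fin n → ℝ, (∀ i, 0 < l i) ∧ x'.1 = scaleWeights l x.1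
  iseqv :=
    { refl := fun x => ⟨fun _ => 1, fun _ => one_pos, (scaleWeights_one x.1).symm⟩
      symm := by
        rintro x x' ⟨l, hl, h⟩
        refine ⟨fun i => (l i)⁻¹, fun i => inv_pos.2 (hl i), ?_⟩
        rw [h, scaleWeights_mul]
        simp [fun i => inv_mul_cancel₀ (hl i).ne', scaleWeights_one]
      trans := by
        rintro x x' x'' ⟨l, hl, h⟩ ⟨l', hl', h'⟩
        exact ⟨fun i => l' i * l i, fun i => mul_pos (hl' i) (hl i),
          by rw [h', h, scaleWeights_mul]⟩ }

/-- Two candidate parameters are equivalent if a positive scaling takes one to the other. -/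
def candSetoid (d n m : ℕ) : Setoid (CandIdx d n m → ℝ) where
  r y y' := ∃ l : Fin n → ℝ, (∀ i, 0 < l i) ∧ y' = scaleCand l y
  iseqv :=
    { refl := fun y => ⟨fun _ => 1, fun _ => one_pos, (scaleCand_one y).symm⟩
      symm := by
        rintro y y' ⟨l, hl, h⟩
        refine ⟨fun i => (l i)⁻¹, fun i => inv_pos.2 (hl i), ?_⟩
        rw [h, scaleCand_mul]
        simp [fun i => inv_mul_cancel₀ (hl i).ne', scaleCand_one]
      trans := by
        rintro y y' y'' ⟨l, hl, h⟩ ⟨l', hl', h'⟩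
        exact ⟨fun i => l' i * l i, fun i => mul_pos (hl' i) (hl i),
          by rw [h', h, scaleCand_mul]⟩ }

/-- The parameter space for maxout polytopes. -/
abbrev WeightQuotient (d n m : ℕ) : Type := Quotient (weightSetoid d n m)

/-- The space of maxout candidates. -/
abbrev CandQuotient (d n m : ℕ) : Type := Quotient (candSetoid d n m)

/-- `φ` is equivariant under the scaling actions. -/
theorem phi_scale {l : Fin n → ℝ} (hl : ∀ i, 0 < l i) (x x' : weightSpace d n m)
    (h : x'.1 = scaleWeights l x.1) : phi x' = scaleCand l (phi x) := by
  have hl' : ∀ i, l i ≠ 0 := fun i => (hl i).ne'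
  funext e
  rcases e with ⟨j, i⟩ | ((⟨j, k⟩ | ⟨j, k⟩) | (⟨k, i⟩ | ⟨k, i⟩))
  · simp [phi, h, scaleCand, candU, scaleWeights, weightA, weightB]
    ring
  · simp only [phi, h, scaleCand, candV, Matrix.transpose_apply, Matrix.mul_apply, Matrix.of_apply]
    refine Finset.sum_congr rfl fun i _ => ?_
    simp only [scaleWeights, weightA, weightC, Matrix.of_apply]
    field_simp [hl' i]
  · simp only [phi, h, scaleCand, candW, Matrix.transpose_apply, Matrix.mul_apply, Matrix.of_apply]
    refine Finset.sum_congr rfl fun i _ => ?_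
    simp only [scaleWeights, weightA, weightD, Matrix.of_apply]
    field_simp [hl' i]
  · simp [phi, h, scaleCand, candS, scaleWeights, weightC]
  · simp [phi, h, scaleCand, candT, scaleWeights, weightD]

/-- The map `φ̄` induced by `φ` on the quotients by the scaling actions. -/
def phiBar : WeightQuotient d n m → CandQuotient d n m :=
  Quotient.map phi fun x x' ⟨l, hl, h⟩ => ⟨l, hl, phi_scale hl x x' h⟩

/-- The expected fiber dimension `max (0, d n - 2 d m)`. -/
def expectedDim (d n m : ℕ) : ℕ :=
  (max 0 ((d : ℤ) * n - 2 * d * m)).toNat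

end Maxout

end

namespace Maxout

/-! ### Krull dimension of algebras of finite type over a field -/

/-! Stack `C`, `D` into a `2m × n` matrix `M` and `vᵀ`, `wᵀ` into `V`. A point of the target
prescribes `M` and `V`, and `u` gives `B` from `A`; so a fiber is the solution set of the linear
system `M * A = V`, and the image is given by `M ≥ 0` and solvability (`phiFun_eq_iff`,
`mem_range_phi_iff`). Cramer's rule makes solvability a finite union of polynomial conditions
(`exists_mul_eq_iff`). Where a maximal minor of `M` is nonzero, the system has `(n - 2m) * d` free
entries of `A` if `2m ≤ n`, and at most one solution if `n ≤ 2m` (`exists_generic_poly`). In the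
quotient, the scale-invariant ratios `A / (B - A)` recover `A` wherever `u` has nonzero entries, so
no choice of representatives lowers the dimension.

For the closure, nonnegativity is invisible to polynomials, and a matrix of rank at most `n` factors
as `P * Q` through dimension `n`; when the top block of `P` is invertible this factorization yields
weights, and the remaining points are limits of such points (`zariskiClosure_range_phi`).

Dimensions are bounded above by embedding coordinate rings into polynomial rings
(`semialgDim_le_card`) and below by independent rational functions (`card_le_semialgDim`). Both rest
on Noether normalization. -/

/-- Incomparability: contraction along an integral extension keeps inclusions of primes strict. -/
theorem ringKrullDim_le_of_isIntegral {R S : Type*} [CommRing R] [CommRing S] [Algebra R S]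
    [Algebra.IsIntegral R S] : ringKrullDim S ≤ ringKrullDim R :=
  Order.krullDim_le_of_strictMono (PrimeSpectrum.comap (algebraMap R S)) fun P Q h =>
    Ideal.IsIntegral.comap_lt_comap (R := R) (I := P.asIdeal) (J := Q.asIdeal) h

/-- Lying over starts a chain above the given one, and going up continues it. -/
theorem le_ringKrullDim_of_isIntegral {R S : Type*} [CommRing R] [CommRing S] [Algebra R S]
    [Algebra.IsIntegral R S] [FaithfulSMul R S] : ringKrullDim R ≤ ringKrullDim S := by
  refine iSup_le fun l => ?_
  obtain ⟨⟨P, hP, hPl⟩⟩ := Ideal.nonempty_primesOver (S := S) (RelSeries.head l).asIdeal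
  obtain ⟨L, hL, -⟩ := Ideal.exists_ltSeries_of_hasGoingUp l P
  rw [← hL]
  exact Order.LTSeries.length_le_krullDim L

theorem ringKrullDim_le_of_isLocalization {R : Type*} (S : Type*) [CommRing R] [CommRing S]
    [Algebra R S] (M : Submonoid R) [IsLocalization M S] : ringKrullDim S ≤ ringKrullDim R :=
  Order.krullDim_le_of_strictMono (PrimeSpectrum.comap (algebraMap R S))
    (Monotone.strictMono_of_injective (fun _ _ h => Ideal.comap_mono h)
      (PrimeSpectrum.localization_comap_injective S M))

/-- An algebra of finite type over a field that embeds into a polynomial ring in finitely many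
variables has dimension at most the number of variables. -/
theorem ringKrullDim_le_card_of_injective {k S τ : Type} [Field k] [CommRing S] [Nontrivial S]
    [Algebra k S] [Algebra.FiniteType k S] [Fintype τ] (f : S →ₐ[k] MvPolynomial τ k)
    (hf : Function.Injective f) : ringKrullDim S ≤ (Fintype.card τ : WithBot ℕ∞) := by
  -- Noether normalization. The `s` variables stay algebraically independent in `MvPolynomial τ k`,
  -- which bounds `s` by transcendence degree.
  obtain ⟨s, g, hg, hint⟩ := exists_integral_inj_algHom_of_fg k S
  have hs : s ≤ Fintype.card τ := by
    have h := trdeg_le_of_injective (f.comp g) (hf.comp hg)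
    simpa using h
  algebraize [g.toRingHom]
  have : Algebra.IsIntegral (MvPolynomial (Fin s) k) S := ⟨hint⟩
  refine (ringKrullDim_le_of_isIntegral (R := MvPolynomial (Fin s) k)).trans ?_
  rw [MvPolynomial.ringKrullDim_of_isNoetherianRing, ringKrullDim_eq_zero_of_field]
  simpa using hs

/-- After Noether normalization `S` is algebraic over a polynomial ring in `s` variables; additivity
of transcendence degree then bounds independent families by `s`, the dimension. -/
theorem card_le_ringKrullDim_of_isDomain {k S κ : Type} [Field k] [CommRing S] [IsDomain S]
    [Algebra k S] [Algebra.FiniteType k S] [Fintype κ] {x : κ → S}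
    (hx : AlgebraicIndependent k x) : (Fintype.card κ : WithBot ℕ∞) ≤ ringKrullDim S := by
  obtain ⟨s, g, hg, hint⟩ := exists_integral_inj_algHom_of_fg k S
  algebraize [g.toRingHom]
  have hI : Algebra.IsIntegral (MvPolynomial (Fin s) k) S := ⟨hint⟩
  have hF : FaithfulSMul (MvPolynomial (Fin s) k) S :=
    (faithfulSMul_iff_algebraMap_injective _ _).2 hg
  have : IsScalarTower k (MvPolynomial (Fin s) k) S := .of_algebraMap_eq fun r => (g.commutes r).symm
  have hle : Fintype.card κ ≤ s := by
    have h1 := trdeg_add_eq k (MvPolynomial (Fin s) k) (A := S)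
    have h2 := hx.cardinalMk_le_trdeg
    rw [← h1, trdeg_eq_zero (R := MvPolynomial (Fin s) k)] at h2
    simpa using h2
  refine le_trans ?_ (le_ringKrullDim_of_isIntegral (R := MvPolynomial (Fin s) k))
  rw [MvPolynomial.ringKrullDim_of_isNoetherianRing, ringKrullDim_eq_zero_of_field]
  simpa using hle

/-- The dimension of an algebra of finite type over a field is at least the number of elements of
an algebraically independent family. -/
theorem card_le_ringKrullDim {k S κ : Type} [Field k] [CommRing S]
    [Algebra k S] [Algebra.FiniteType k S] [Fintype κ] {x : κ → S}
    (hx : AlgebraicIndependent k x) : (Fintype.card κ : WithBot ℕ∞) ≤ ringKrullDim S := by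
  -- The nonzero polynomials in `x` form a multiplicative set avoiding `0`. A prime disjoint from it
  -- keeps `x` independent in the quotient, which reduces to domains.
  have hdisj : Disjoint ((⊥ : Ideal S) : Set S)
      ((nonZeroDivisors (MvPolynomial κ k)).map (aeval (R := k) x).toRingHom : Set S) := by
    rw [Set.disjoint_left]
    rintro _ h0 ⟨q, hq, rfl⟩
    exact nonZeroDivisors.ne_zero hq (hx (by simpa using h0))
  obtain ⟨P, hP, -, hdisj⟩ := Ideal.exists_le_prime_disjoint _ _ hdisj
  have hind : AlgebraicIndependent k (fun i => Ideal.Quotient.mkₐ k P (x i)) := by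
    refine (injective_iff_map_eq_zero _).2 fun q hq => ?_
    by_contra h0
    refine Set.disjoint_left.1 hdisj ?_ ⟨q, mem_nonZeroDivisors_of_ne_zero h0, rfl⟩
    have h1 : Ideal.Quotient.mkₐ k P (aeval x q) = 0 := by
      rw [← hq, comp_aeval_apply]
    exact Ideal.Quotient.eq_zero_iff_mem.1 h1
  exact (card_le_ringKrullDim_of_isDomain hind).trans (ringKrullDim_quotient_le P)

/-! ### Zariski closure, dimension and semialgebraic sets -/

theorem mem_zariskiClosure_iff {σ : Type} {S : Set (σ → ℝ)} {x : σ → ℝ} :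
    x ∈ zariskiClosure S ↔
      ∀ f : MvPolynomial σ ℝ, (∀ y ∈ S, eval y f = 0) → eval x f = 0 := Iff.rfl

theorem subset_zariskiClosure {σ : Type} (S : Set (σ → ℝ)) : S ⊆ zariskiClosure S :=
  fun _ hx => mem_zariskiClosure_iff.2 fun _ hf => hf _ hx

/-- Closedness here is Euclidean, which lets limits of points of a Zariski closure stay in it. -/
theorem isClosed_zariskiClosure {σ : Type} (S : Set (σ → ℝ)) : IsClosed (zariskiClosure S) := by
  have : zariskiClosure S =
      ⋂ (f : MvPolynomial σ ℝ) (_ : ∀ y ∈ S, eval y f = 0), {x | eval x f = 0} := by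
    ext x
    simp [mem_zariskiClosure_iff]
  rw [this]
  exact isClosed_biInter fun f _ => isClosed_singleton.preimage (continuous_eval f)

theorem zariskiClosure_eq_of_forall {σ : Type} {S T : Set (σ → ℝ)} (hST : S ⊆ T)
    (h : ∀ f : MvPolynomial σ ℝ, (∀ y ∈ S, eval y f = 0) → ∀ y ∈ T, eval y f = 0) :
    zariskiClosure S = zariskiClosure T := by
  ext x
  exact ⟨fun hx f hf => hx f fun y hy => hf y (hST hy), fun hx f hf => hx f (h f hf)⟩

theorem semialgDim_zariskiClosure {σ : Type} (S : Set (σ → ℝ)) :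
    semialgDim (zariskiClosure S) = semialgDim S := by
  have : vanishingIdeal ℝ (zariskiClosure S) = vanishingIdeal ℝ S :=
    le_antisymm (vanishingIdeal_anti_mono (subset_zariskiClosure S))
      (le_vanishingIdeal_zeroLocus _)
  rw [semialgDim, semialgDim, this]

theorem semialgDim_univ {σ : Type} [Fintype σ] :
    semialgDim (Set.univ : Set (σ → ℝ)) = (Fintype.card σ : WithBot ℕ∞) := by
  have : vanishingIdeal ℝ (Set.univ : Set (σ → ℝ)) = ⊥ := by
    refine eq_bot_iff.2 fun f hf => ?_
    exact MvPolynomial.funext fun x => by simpa using hf x trivial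
  rw [semialgDim, this,
    ringKrullDim_eq_of_ringEquiv (RingEquiv.quotientBot (MvPolynomial σ ℝ)),
    MvPolynomial.ringKrullDim_of_isNoetherianRing, ringKrullDim_eq_zero_of_field]
  simp

/-- A polynomial that vanishes on a nonempty open set is zero. -/
theorem eq_zero_of_isOpen {τ : Type} [Fintype τ] {U : Set (τ → ℝ)} (hU : IsOpen U)
    (hne : U.Nonempty) {q : MvPolynomial τ ℝ} (h : ∀ x ∈ U, eval x q = 0) : q = 0 := by
  obtain ⟨x, hx⟩ := hne
  obtain ⟨ε, hε, hball⟩ := Metric.isOpen_iff.1 hU x hx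
  -- A ball in the sup metric is a product of intervals, and a polynomial vanishing on a product of
  -- infinite sets is zero.
  refine funext_set (fun i => Metric.ball (x i) ε) (fun i => ?_) fun y hy => ?_
  · rw [Real.ball_eq_Ioo]
    exact Set.Ioo_infinite (by linarith)
  · rw [map_zero]
    exact h y (hball (by rwa [ball_pi x hε]))

theorem eval_aeval {σ τ : Type} (h : σ → MvPolynomial τ ℝ) (f : MvPolynomial σ ℝ) (y : τ → ℝ) :
    eval y (aeval h f) = eval (fun e => eval y (h e)) f := by
  have := comp_aeval_apply (f := h) (aeval (R := ℝ) y) f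
  simpa [coe_aeval_eq_eval] using this

/-- A set that is the image of a Zariski dense set under a polynomial map on affine space has
dimension at most that of the affine space. -/
theorem semialgDim_le_card {σ τ : Type} [Finite σ] [Fintype τ] (h : σ → MvPolynomial τ ℝ)
    {T : Set (σ → ℝ)} (hne : T.Nonempty) (hT : T ⊆ Set.range fun y e => eval y (h e))
    (hdense : ∀ f : MvPolynomial σ ℝ, (∀ x ∈ T, eval x f = 0) → aeval h f = 0) :
    semialgDim T ≤ (Fintype.card τ : WithBot ℕ∞) := by
  have hnt : Nontrivial (MvPolynomial σ ℝ ⧸ vanishingIdeal ℝ T) := by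
    refine Ideal.Quotient.nontrivial_iff.2 fun htop => ?_
    obtain ⟨x, hx⟩ := hne
    have h1 : (1 : MvPolynomial σ ℝ) ∈ vanishingIdeal ℝ T := htop ▸ Submodule.mem_top
    simpa using h1 x hx
  -- Pullback along `h` kills the vanishing ideal by density; since `T` lies in the range of `h`,
  -- nothing else is killed.
  refine ringKrullDim_le_card_of_injective
    (Ideal.Quotient.liftₐ (vanishingIdeal ℝ T) (aeval h) fun f hf => hdense f hf) ?_
  refine (injective_iff_map_eq_zero _).2 fun r hr => ?_
  obtain ⟨f, rfl⟩ := Ideal.Quotient.mk_surjective r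
  refine Ideal.Quotient.eq_zero_iff_mem.2 fun x hx => ?_
  obtain ⟨y, rfl⟩ := hT hx
  have hf : aeval h f = 0 := hr
  change eval (fun e => eval y (h e)) f = 0
  rw [← eval_aeval, hf, map_zero]

/-- A set with a map to affine space given by rational functions without poles on the set, and
with Zariski dense image, has dimension at least that of the affine space. -/
theorem card_le_semialgDim {σ κ : Type} [Finite σ] [Fintype κ] {T : Set (σ → ℝ)}
    (a b : κ → MvPolynomial σ ℝ) (hb : ∀ x ∈ T, ∀ k, eval x (b k) ≠ 0)
    (hdense : ∀ q : MvPolynomial κ ℝ,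
      (∀ x ∈ T, eval (fun k => eval x (a k) / eval x (b k)) q = 0) → q = 0) :
    (Fintype.card κ : WithBot ℕ∞) ≤ semialgDim T := by
  let R := MvPolynomial σ ℝ ⧸ vanishingIdeal ℝ T
  let π : MvPolynomial σ ℝ →ₐ[ℝ] R := Ideal.Quotient.mkₐ ℝ (vanishingIdeal ℝ T)
  -- Inverting all denominators at once makes the quotients `a k / b k` elements of a localization,
  -- whose dimension is at most that of `R`. Evaluation at a point of `T` extends to it.
  let M : Submonoid R := Submonoid.powers (π (∏ k, b k))
  have hunit : ∀ k, IsUnit (algebraMap R (Localization M) (π (b k))) := fun k => by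
    have h1 : IsUnit (algebraMap R (Localization M) (π (∏ k, b k))) :=
      IsLocalization.map_units (Localization M) (⟨_, Submonoid.mem_powers _⟩ : M)
    rw [map_prod, map_prod] at h1
    exact isUnit_of_dvd_unit (Finset.dvd_prod_of_mem _ (Finset.mem_univ k)) h1
  let g : κ → Localization M := fun k =>
    algebraMap R (Localization M) (π (a k)) * ((hunit k).unit⁻¹ : (Localization M)ˣ)
  have hg : ∀ k, g k * algebraMap R (Localization M) (π (b k)) =
      algebraMap R (Localization M) (π (a k)) := fun k => by
    simp [g, mul_assoc]
  have hind : AlgebraicIndependent ℝ g := by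
    refine (injective_iff_map_eq_zero _).2 fun q hq => hdense q fun x hx => ?_
    let ev : R →ₐ[ℝ] ℝ := Ideal.Quotient.liftₐ (vanishingIdeal ℝ T) (aeval x) fun f hf => hf x hx
    have hev : ∀ f, ev (π f) = eval x f := fun f => rfl
    have hM : ∀ y : M, IsUnit (ev y) := by
      rintro ⟨_, N, rfl⟩
      rw [isUnit_iff_ne_zero]
      simpa [hev, map_prod, Finset.prod_ne_zero_iff] using
        fun h0 : ∏ k, eval x (b k) = 0 =>
          absurd h0 (Finset.prod_ne_zero_iff.2 fun k _ => hb x hx k)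
    let ev' : Localization M →ₐ[ℝ] ℝ := IsLocalization.liftAlgHom (M := M) (S := Localization M) (f := ev) hM
    have hev' : ∀ f, ev' (algebraMap R (Localization M) (π f)) = eval x f := fun f => by
      rw [← hev]
      exact IsLocalization.lift_eq _ _
    have hgk : ∀ k, eval x (a k) / eval x (b k) = ev' (g k) := fun k => by
      rw [div_eq_iff (hb x hx k), ← hev', ← hev', ← map_mul, hg]
    simp_rw [hgk]
    have := comp_aeval_apply (f := g) ev' q
    rw [hq, map_zero] at this
    simpa [coe_aeval_eq_eval] using this.symm
  exact (card_le_ringKrullDim hind).trans (ringKrullDim_le_of_isLocalization (Localization M) M)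

namespace IsSemialgebraic

variable {σ : Type}

theorem univ : IsSemialgebraic (Set.univ : Set (σ → ℝ)) := by
  simpa using IsSemialgebraic.pos (1 : MvPolynomial σ ℝ)

theorem inter {S T : Set (σ → ℝ)} (hS : IsSemialgebraic S) (hT : IsSemialgebraic T) :
    IsSemialgebraic (S ∩ T) := by
  simpa [Set.compl_union] using (hS.compl.union hT.compl).compl

theorem nonneg (p : MvPolynomial σ ℝ) : IsSemialgebraic {x | 0 ≤ eval x p} := by
  have h := (IsSemialgebraic.pos (-p)).compl
  have e : {x : σ → ℝ | 0 < eval x (-p)}ᶜ = {x | 0 ≤ eval x p} := by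
    ext x
    simp
  rwa [e] at h

theorem eq_zero (p : MvPolynomial σ ℝ) : IsSemialgebraic {x | eval x p = 0} := by
  have h := (nonneg p).inter (nonneg (-p))
  have e : {x : σ → ℝ | 0 ≤ eval x p} ∩ {x | 0 ≤ eval x (-p)} = {x | eval x p = 0} := by
    ext x
    simp [le_antisymm_iff, and_comm]
  rwa [e] at h

theorem iInter {ι : Type} [Finite ι] {S : ι → Set (σ → ℝ)} (hS : ∀ i, IsSemialgebraic (S i)) :
    IsSemialgebraic (⋂ i, S i) := by
  have h : ∀ s : Set ι, s.Finite → IsSemialgebraic (⋂ i ∈ s, S i) := fun s hs => by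
    induction s, hs using Set.Finite.induction_on with
    | empty => simpa using univ
    | insert _ _ ih =>
      rw [Set.biInter_insert]
      exact (hS _).inter ih
  simpa using h Set.univ Set.finite_univ

theorem iUnion {ι : Type} [Finite ι] {S : ι → Set (σ → ℝ)} (hS : ∀ i, IsSemialgebraic (S i)) :
    IsSemialgebraic (⋃ i, S i) := by
  have h := (iInter fun i => (hS i).compl).compl
  simpa [Set.compl_iInter] using h

end IsSemialgebraic

/-! ### Minors and linear systems -/

section LinearAlgebra

variable {p q : Type} [Fintype q]

/-- Choose a basis of the column space among the columns, then a basis of the row space of what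
remains. The span statement allows the chosen columns to replace `M` in linear systems. -/
theorem exists_minor [Fintype p] (M : Matrix p q ℝ) :
    ∃ (I : Fin M.rank → p) (J : Fin M.rank → q), (M.submatrix I J).det ≠ 0 ∧
      Submodule.span ℝ (Set.range (M.submatrix id J).col) = Submodule.span ℝ (Set.range M.col) := by
  obtain ⟨κ, a, ha, hspan, hli⟩ := exists_linearIndependent' ℝ M.col
  have : Finite κ := Finite.of_injective a ha
  have := Fintype.ofFinite κ
  have hcard : Fintype.card κ = M.rank := by
    rw [M.rank_eq_finrank_span_cols, ← hspan, finrank_span_eq_card hli]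
  let e : Fin M.rank ≃ κ := (Fintype.equivFinOfCardEq hcard).symm
  let N : Matrix p (Fin M.rank) ℝ := M.submatrix id (a ∘ e)
  have hNspan : Submodule.span ℝ (Set.range N.col) = Submodule.span ℝ (Set.range M.col) := by
    rw [← hspan, ← e.surjective.range_comp (M.col ∘ a)]
    rfl
  have hNrank : N.rank = M.rank := by
    rw [N.rank_eq_finrank_span_cols, hNspan, ← M.rank_eq_finrank_span_cols]
  obtain ⟨κ', a', ha', hspan', hli'⟩ := exists_linearIndependent' ℝ N.row
  have : Finite κ' := Finite.of_injective a' ha'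
  have := Fintype.ofFinite κ'
  have hcard' : Fintype.card κ' = M.rank := by
    rw [← hNrank, N.rank_eq_finrank_span_row, ← hspan', finrank_span_eq_card hli']
  let e' : Fin M.rank ≃ κ' := (Fintype.equivFinOfCardEq hcard').symm
  refine ⟨a' ∘ e', a ∘ e, ?_, hNspan⟩
  have hrows : LinearIndependent ℝ (M.submatrix (a' ∘ e') (a ∘ e)).row :=
    hli'.comp e' e'.injective
  exact ((Matrix.isUnit_iff_isUnit_det _).1
    (Matrix.linearIndependent_rows_iff_isUnit.1 hrows)).ne_zero

/-- The inclusion of coordinates `J`, as a matrix. -/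
def inclMatrix {r : Type} [DecidableEq q] (R : Type) [CommRing R] (J : r → q) : Matrix q r R :=
  (1 : Matrix q q R).submatrix id J

theorem mul_inclMatrix {r R : Type} [DecidableEq q] [CommRing R] (M : Matrix p q R) (J : r → q) :
    M * inclMatrix R J = M.submatrix id J := by
  ext i j
  simp [inclMatrix, Matrix.mul_apply, Matrix.one_apply]

theorem exists_mul_eq_of_span_le {p' r : Type} [Fintype r] (M : Matrix p q ℝ)
    (N : Matrix p r ℝ) (h : Submodule.span ℝ (Set.range M.col) ≤ Submodule.span ℝ (Set.range N.col))
    (A : Matrix q p' ℝ) : ∃ B : Matrix r p' ℝ, M * A = N * B := by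
  have h1 : ∀ j, ∃ b : r → ℝ, N *ᵥ b = M *ᵥ (fun k => A k j) := fun j => by
    have h2 : M *ᵥ (fun k => A k j) ∈ Submodule.span ℝ (Set.range N.col) := by
      refine h ?_
      rw [← Matrix.range_mulVecLin]
      exact ⟨_, rfl⟩
    rw [← Matrix.range_mulVecLin] at h2
    exact h2
  choose b hb using h1
  refine ⟨Matrix.of fun k j => b j k, ?_⟩
  ext i j
  exact (congrFun (hb j) i).symm

/-- Cramer's criterion for the solvability of `M * A = V`. -/
theorem exists_mul_eq_iff [Fintype p] {p' : Type} [DecidableEq q] (M : Matrix p q ℝ) (V : Matrix p p' ℝ) :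
    (∃ A : Matrix q p' ℝ, M * A = V) ↔
      ∃ r : Fin (Fintype.card q + 1), ∃ (I : Fin r → p) (J : Fin r → q),
        (M.submatrix I J).det ≠ 0 ∧
        M.submatrix id J * ((M.submatrix I J).adjugate * V.submatrix I id) -
          (M.submatrix I J).det • V = 0 := by
  constructor
  · rintro ⟨A, rfl⟩
    obtain ⟨I, J, hdet, hspan⟩ := exists_minor M
    obtain ⟨B, hB⟩ := exists_mul_eq_of_span_le M (M.submatrix id J) hspan.ge A
    -- The rank is at most the number of columns, so finitely many sizes `r` suffice.
    refine ⟨⟨M.rank, Nat.lt_succ_of_le M.rank_le_card_width⟩, I, J, hdet, ?_⟩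
    rw [sub_eq_zero, hB]
    have : (M.submatrix id J * B).submatrix I id = M.submatrix I J * B := rfl
    rw [this, ← Matrix.mul_assoc (adjugate _), Matrix.adjugate_mul, Matrix.smul_mul,
      Matrix.one_mul, Matrix.mul_smul]
  · rintro ⟨r, I, J, hdet, h⟩
    rw [sub_eq_zero] at h
    -- Cramer's solution on the columns `J`, extended by zero to the other coordinates.
    refine ⟨inclMatrix ℝ J * ((M.submatrix I J).det⁻¹ •
      ((M.submatrix I J).adjugate * V.submatrix I id)), ?_⟩
    rw [← Matrix.mul_assoc, mul_inclMatrix, Matrix.mul_smul, h, smul_smul, inv_mul_cancel₀ hdet,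
      one_smul]

/-- A matrix of rank at most `n` is a product of matrices with inner dimension `n`. -/
theorem exists_eq_mul_of_rank_le [Fintype p] (M : Matrix p q ℝ) {n : ℕ} (h : M.rank ≤ n) :
    ∃ (P : Matrix p (Fin n) ℝ) (Q : Matrix (Fin n) q ℝ), M = P * Q := by
  classical
  obtain ⟨I, J, -, hspan⟩ := exists_minor M
  obtain ⟨B, hB⟩ := exists_mul_eq_of_span_le M (M.submatrix id J) hspan.ge
    (1 : Matrix q q ℝ)
  -- Zero padding raises the inner dimension from the rank to `n`; `Eᵀ * E = 1` leaves the product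
  -- unchanged.
  let E : Matrix (Fin n) (Fin M.rank) ℝ := inclMatrix ℝ (Fin.castLE h)
  have hE : Eᵀ * E = 1 := by
    rw [mul_inclMatrix]
    ext i j
    simp [E, inclMatrix, Matrix.one_apply]
  refine ⟨M.submatrix id J * Eᵀ, E * B, ?_⟩
  rw [Matrix.mul_assoc, ← Matrix.mul_assoc Eᵀ, hE, Matrix.one_mul, ← hB, Matrix.mul_one]

end LinearAlgebra

theorem det_submatrix_mul_eq_zero {R p q : Type} [Field R] {r n : ℕ} (P : Matrix p (Fin n) R)
    (Q : Matrix (Fin n) q R) (h : n < r) (I : Fin r → p) (J : Fin r → q) :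
    ((P * Q).submatrix I J).det = 0 := by
  by_contra h0
  have h1 := Matrix.rank_of_det_ne_zero h0
  have h2 : (P * Q).submatrix I J = P.submatrix I id * Q.submatrix id J := rfl
  have h3 := (Matrix.rank_mul_le_left (P.submatrix I id) (Q.submatrix id J)).trans
    (Matrix.rank_le_width _)
  rw [← h2, h1, Fintype.card_fin] at h3
  omega

/-- The general solution of `M * A = V`, when the columns of `M` indexed by `p` form an invertible
matrix: it is parametrized by the other rows of `A`. -/
theorem exists_param_of_det_cols_ne_zero {p q p' c : Type} [Fintype p] [Fintype q] [Fintype c]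
    [DecidableEq p] (M : Matrix p q ℝ) (V : Matrix p p' ℝ) (e : p ⊕ c ≃ q)
    (hdet : (M.submatrix id (e ∘ Sum.inl)).det ≠ 0) :
    ∃ S : Matrix q p' (MvPolynomial (c × p') ℝ),
      (∀ a, M * S.map (eval a) = V) ∧ (∀ a k, eval a (S (e (.inr k.1)) k.2) = a k) ∧
      ∀ A, M * A = V → A = S.map (eval fun k => A (e (.inr k.1)) k.2) := by
  have hu := hdet.isUnit
  have hmul : ∀ A : Matrix q p' ℝ, M * A =
      M.submatrix id (e ∘ Sum.inl) * A.submatrix (e ∘ Sum.inl) id +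
        M.submatrix id (e ∘ Sum.inr) * A.submatrix (e ∘ Sum.inr) id := fun A => by
    ext i j
    simp only [Matrix.mul_apply, Matrix.add_apply, Matrix.submatrix_apply, id, Function.comp]
    rw [← e.sum_comp, Fintype.sum_sum_type]
  -- The pivot rows of `A` as an affine function of the free rows `a`.
  let sol : Matrix c p' ℝ → Matrix p p' ℝ := fun a =>
    (M.submatrix id (e ∘ Sum.inl))⁻¹ * (V - M.submatrix id (e ∘ Sum.inr) * a)
  let Y : Matrix c p' (MvPolynomial (c × p') ℝ) := Matrix.of fun i j => X (i, j)
  let M₁ : Matrix p p (MvPolynomial (c × p') ℝ) := (M.submatrix id (e ∘ Sum.inl))⁻¹.map C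
  let M₂ : Matrix p c (MvPolynomial (c × p') ℝ) := (M.submatrix id (e ∘ Sum.inr)).map C
  let V' : Matrix p p' (MvPolynomial (c × p') ℝ) := V.map C
  let S : Matrix q p' (MvPolynomial (c × p') ℝ) :=
    (Matrix.fromRows (M₁ * (V' - M₂ * Y)) Y).submatrix e.symm id
  have hC : ∀ {r s : Type} (L : Matrix r s ℝ) (a : c × p' → ℝ),
      (L.map (C (σ := c × p'))).map (eval a) = L := fun L a => by
    ext i j
    simp
  have hY : ∀ a : c × p' → ℝ, Y.map (eval a) = Matrix.of fun i j => a (i, j) := fun a => by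
    ext i j
    simp [Y]
  have hS₁ : ∀ a : c × p' → ℝ, (S.map (eval a)).submatrix (e ∘ Sum.inl) id =
      sol (Matrix.of fun i j => a (i, j)) := fun a => by
    have : (S.map (eval a)).submatrix (e ∘ Sum.inl) id =
        (M₁ * (V' - M₂ * Y)).map (eval a) := by
      ext i j
      simp [S]
    rw [this, Matrix.map_mul, Matrix.map_sub _ (map_sub (eval a)), Matrix.map_mul, hC, hC, hC, hY]
  have hS₂ : ∀ a : c × p' → ℝ, (S.map (eval a)).submatrix (e ∘ Sum.inr) id =
      Matrix.of fun i j => a (i, j) := fun a => by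
    ext i j
    simp [S, Y]
  refine ⟨S, fun a => ?_, fun a k => congrFun (congrFun (hS₂ a) k.1) k.2, fun A hA => ?_⟩
  · rw [hmul, hS₁, hS₂, Matrix.mul_nonsing_inv_cancel_left _ _ hu, sub_add_cancel]
  · have h₁ : A.submatrix (e ∘ Sum.inl) id = sol (A.submatrix (e ∘ Sum.inr) id) := by
      simp only [sol]
      rw [← hA, hmul, add_sub_cancel_right, Matrix.nonsing_inv_mul_cancel_left _ _ hu]
    have h₁' := h₁.trans (hS₁ fun k => A (e (.inr k.1)) k.2).symm
    have h₂' := hS₂ fun k => A (e (.inr k.1)) k.2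
    ext i j
    obtain ⟨k | k, rfl⟩ := e.surjective i
    · exact congrFun (congrFun h₁' k) j
    · exact (congrFun (congrFun h₂' k) j).symm

theorem eq_of_det_rows_ne_zero {p q p' : Type} [Fintype q] [DecidableEq q] (M : Matrix p q ℝ)
    (e : q → p) (hdet : (M.submatrix e id).det ≠ 0) {A A' : Matrix q p' ℝ}
    (h : M * A = M * A') : A = A' := by
  have h1 : M.submatrix e id * A = M.submatrix e id * A' :=
    congrArg (fun W : Matrix p p' ℝ => W.submatrix e id) h
  rw [← Matrix.nonsing_inv_mul_cancel_left _ A hdet.isUnit, h1,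
    Matrix.nonsing_inv_mul_cancel_left _ A' hdet.isUnit]

variable {d n m : ℕ}

/-! ### The map `φ` in coordinates -/

/-- The matrices `C` and `D`, stacked. -/
def weightCD (x : WeightIdx d n m → ℝ) : Matrix (Fin m ⊕ Fin m) (Fin n) ℝ :=
  Matrix.fromRows (weightC x) (weightD x)

/-- The matrices `s` and `t`, stacked. -/
def candST (y : CandIdx d n m → ℝ) : Matrix (Fin m ⊕ Fin m) (Fin n) ℝ :=
  Matrix.fromRows (candS y) (candT y)

/-- The matrices `vᵀ` and `wᵀ`, stacked. -/
def candVW (y : CandIdx d n m → ℝ) : Matrix (Fin m ⊕ Fin m) (Fin d) ℝ :=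
  Matrix.fromRows (candV y)ᵀ (candW y)ᵀ

/-- The tuple with the given entries. -/
def mkWeights {R : Type} (A B : Matrix (Fin n) (Fin d) R) (M : Matrix (Fin m ⊕ Fin m) (Fin n) R) :
    WeightIdx d n m → R
  | .inl (.inl (i, j)) => A i j
  | .inl (.inr (i, j)) => B i j
  | .inr (.inl (k, i)) => M (.inl k) i
  | .inr (.inr (k, i)) => M (.inr k) i

theorem weights_ext {x x' : WeightIdx d n m → ℝ} (hA : weightA x = weightA x')
    (hB : weightB x = weightB x') (hCD : weightCD x = weightCD x') : x = x' := by
  funext e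
  rcases e with (⟨i, j⟩ | ⟨i, j⟩) | (⟨k, i⟩ | ⟨k, i⟩)
  · exact congrFun (congrFun hA i) j
  · exact congrFun (congrFun hB i) j
  · exact congrFun (congrFun hCD (.inl k)) i
  · exact congrFun (congrFun hCD (.inr k)) i

theorem cand_ext {y y' : CandIdx d n m → ℝ} (hU : candU y = candU y')
    (hVW : candVW y = candVW y') (hST : candST y = candST y') : y = y' := by
  funext e
  rcases e with ⟨j, i⟩ | ((⟨j, k⟩ | ⟨j, k⟩) | (⟨k, i⟩ | ⟨k, i⟩))
  · exact congrFun (congrFun hU j) i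
  · exact congrFun (congrFun hVW (.inl k)) j
  · exact congrFun (congrFun hVW (.inr k)) j
  · exact congrFun (congrFun hST (.inl k)) i
  · exact congrFun (congrFun hST (.inr k)) i

@[simp] theorem weightA_mkWeights (A B : Matrix (Fin n) (Fin d) ℝ)
    (M : Matrix (Fin m ⊕ Fin m) (Fin n) ℝ) : weightA (mkWeights A B M) = A := rfl

@[simp] theorem weightB_mkWeights (A B : Matrix (Fin n) (Fin d) ℝ)
    (M : Matrix (Fin m ⊕ Fin m) (Fin n) ℝ) : weightB (mkWeights A B M) = B := rfl

@[simp] theorem weightCD_mkWeights (A B : Matrix (Fin n) (Fin d) ℝ)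
    (M : Matrix (Fin m ⊕ Fin m) (Fin n) ℝ) : weightCD (mkWeights A B M) = M := by
  ext (k | k) i <;> rfl

theorem mem_weightSpace_iff {x : WeightIdx d n m → ℝ} :
    x ∈ weightSpace d n m ↔ ∀ k i, 0 ≤ weightCD x k i := by
  rw [Sum.forall]
  rfl

/-- The extension of `φ` to tuples `(A, B, C, D)` without sign conditions. -/
def phiFun (x : WeightIdx d n m → ℝ) : CandIdx d n m → ℝ
  | .inl (j, i) => (weightB x - weightA x)ᵀ j i
  | .inr (.inl (.inl (j, k))) => (weightC x * weightA x)ᵀ j k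
  | .inr (.inl (.inr (j, k))) => (weightD x * weightA x)ᵀ j k
  | .inr (.inr (.inl (k, i))) => weightC x k i
  | .inr (.inr (.inr (k, i))) => weightD x k i

theorem phi_eq_phiFun (x : weightSpace d n m) : phi x = phiFun x.1 := by
  funext e
  rcases e with ⟨j, i⟩ | ((⟨j, k⟩ | ⟨j, k⟩) | (⟨k, i⟩ | ⟨k, i⟩)) <;> rfl

theorem candU_phiFun (x : WeightIdx d n m → ℝ) : candU (phiFun x) = (weightB x - weightA x)ᵀ := rfl

theorem candST_phiFun (x : WeightIdx d n m → ℝ) : candST (phiFun x) = weightCD x := rfl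

theorem candVW_phiFun (x : WeightIdx d n m → ℝ) :
    candVW (phiFun x) = weightCD x * weightA x := by
  rw [weightCD, Matrix.fromRows_mul]
  rfl

/-- Only `A` is unknown in a fiber: `C`, `D` are coordinates of `y`, and `u` turns `A` into `B`.
What is left is a linear system. -/
theorem phiFun_eq_iff {x : WeightIdx d n m → ℝ} {y : CandIdx d n m → ℝ} :
    phiFun x = y ↔ weightCD x = candST y ∧ candST y * weightA x = candVW y ∧
      weightB x = weightA x + (candU y)ᵀ := by
  constructor
  · rintro rfl
    refine ⟨rfl, (candVW_phiFun x).symm, ?_⟩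
    rw [candU_phiFun, Matrix.transpose_transpose, add_sub_cancel]
  · rintro ⟨h₁, h₂, h₃⟩
    refine cand_ext ?_ ?_ ?_
    · rw [candU_phiFun, h₃, add_sub_cancel_left, Matrix.transpose_transpose]
    · rw [candVW_phiFun, h₁, h₂]
    · rw [candST_phiFun, h₁]

theorem mem_range_phi_iff {y : CandIdx d n m → ℝ} :
    y ∈ Set.range (phi (d := d) (n := n) (m := m)) ↔
      (∀ k i, 0 ≤ candST y k i) ∧ ∃ A : Matrix (Fin n) (Fin d) ℝ, candST y * A = candVW y := by
  constructor
  · rintro ⟨⟨x, hx⟩, rfl⟩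
    rw [phi_eq_phiFun]
    exact ⟨mem_weightSpace_iff.1 hx, _, (candVW_phiFun x).symm⟩
  · rintro ⟨h0, A, hA⟩
    refine ⟨⟨mkWeights A (A + (candU y)ᵀ) (candST y), mem_weightSpace_iff.2 ?_⟩, ?_⟩
    · simpa using h0
    · rw [phi_eq_phiFun, phiFun_eq_iff]
      simp [hA]

/-! ### Polynomial versions -/

/-- The coordinates of `φ`, as polynomials in the weights. -/
noncomputable def phiPoly : CandIdx d n m → MvPolynomial (WeightIdx d n m) ℝ
  | .inl (j, i) => X (.inl (.inr (i, j))) - X (.inl (.inl (i, j)))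
  | .inr (.inl (.inl (j, k))) => ∑ i, X (.inr (.inl (k, i))) * X (.inl (.inl (i, j)))
  | .inr (.inl (.inr (j, k))) => ∑ i, X (.inr (.inr (k, i))) * X (.inl (.inl (i, j)))
  | .inr (.inr (.inl (k, i))) => X (.inr (.inl (k, i)))
  | .inr (.inr (.inr (k, i))) => X (.inr (.inr (k, i)))

theorem eval_phiPoly (x : WeightIdx d n m → ℝ) : (fun e => eval x (phiPoly e)) = phiFun x := by
  funext e
  rcases e with ⟨j, i⟩ | ((⟨j, k⟩ | ⟨j, k⟩) | (⟨k, i⟩ | ⟨k, i⟩)) <;>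
    simp [phiPoly, phiFun, weightA, weightB, weightC, weightD, Matrix.mul_apply]

/-- The generic matrix `candST`. -/
noncomputable def polyST (d n m : ℕ) :
    Matrix (Fin m ⊕ Fin m) (Fin n) (MvPolynomial (CandIdx d n m) ℝ) :=
  Matrix.fromRows (Matrix.of fun k i => X (.inr (.inr (.inl (k, i)))))
    (Matrix.of fun k i => X (.inr (.inr (.inr (k, i)))))

/-- The generic matrix `candVW`. -/
noncomputable def polyVW (d n m : ℕ) :
    Matrix (Fin m ⊕ Fin m) (Fin d) (MvPolynomial (CandIdx d n m) ℝ) :=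
  Matrix.fromRows (Matrix.of fun k j => X (.inr (.inl (.inl (j, k)))))
    (Matrix.of fun k j => X (.inr (.inl (.inr (j, k)))))

theorem polyST_map (y : CandIdx d n m → ℝ) : (polyST d n m).map (eval y) = candST y := by
  ext (k | k) i <;> simp [polyST, candST, candS, candT]

theorem polyVW_map (y : CandIdx d n m → ℝ) : (polyVW d n m).map (eval y) = candVW y := by
  ext (k | k) i <;> simp [polyVW, candVW, candV, candW]

theorem eval_det {σ r : Type} [Fintype r] [DecidableEq r] (M : Matrix r r (MvPolynomial σ ℝ))
    (y : σ → ℝ) : eval y M.det = (M.map (eval y)).det :=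
  RingHom.map_det (eval y) M

theorem eval_det_submatrix {r : Type} [Fintype r] [DecidableEq r] (I : r → Fin m ⊕ Fin m)
    (J : r → Fin n) (y : CandIdx d n m → ℝ) :
    eval y ((polyST d n m).submatrix I J).det = ((candST y).submatrix I J).det := by
  rw [eval_det, ← Matrix.submatrix_map, polyST_map]

/-- A polynomial that vanishes on the weight space is zero. -/
theorem eq_zero_of_weightSpace {f : MvPolynomial (WeightIdx d n m) ℝ}
    (h : ∀ x ∈ weightSpace d n m, eval x f = 0) : f = 0 := by
  -- The full nonnegative orthant lies in the weight space and is already a product of infinite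
  -- sets.
  refine funext_set (fun _ => Set.Ici 0) (fun _ => Set.Ici_infinite 0) fun x hx => ?_
  rw [map_zero]
  exact h x ⟨fun k i => hx _ trivial, fun k i => hx _ trivial⟩

theorem aeval_phiPoly_eq_zero {f : MvPolynomial (CandIdx d n m) ℝ}
    (h : ∀ y ∈ Set.range (phi (d := d) (n := n) (m := m)), eval y f = 0) :
    aeval phiPoly f = 0 := by
  refine eq_zero_of_weightSpace fun x hx => ?_
  rw [eval_aeval, eval_phiPoly]
  exact h _ ⟨⟨x, hx⟩, phi_eq_phiFun _⟩

/-- Zariski density of the weight space removes the sign conditions, so arbitrary real tuples may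
serve as witnesses. -/
theorem eval_phiFun_eq_zero {f : MvPolynomial (CandIdx d n m) ℝ}
    (h : ∀ y ∈ Set.range (phi (d := d) (n := n) (m := m)), eval y f = 0)
    (x : WeightIdx d n m → ℝ) : eval (phiFun x) f = 0 := by
  rw [← eval_phiPoly, ← eval_aeval, aeval_phiPoly_eq_zero h, map_zero]

theorem aeval_phiPoly_ne_zero {p : MvPolynomial (CandIdx d n m) ℝ} {x : WeightIdx d n m → ℝ}
    (hp : eval (phiFun x) p ≠ 0) : aeval phiPoly p ≠ 0 := fun h => hp <| by
  rw [← eval_phiPoly, ← eval_aeval, h, map_zero]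

/-- The points of the image at which a polynomial does not vanish are Zariski dense in the image
unless there are none. -/
theorem zariskiClosure_ne_zero {p : MvPolynomial (CandIdx d n m) ℝ} {x : WeightIdx d n m → ℝ}
    (hp : eval (phiFun x) p ≠ 0) :
    zariskiClosure {y ∈ Set.range (phi (d := d) (n := n) (m := m)) | eval y p ≠ 0} =
      zariskiClosure (Set.range (phi (d := d) (n := n) (m := m))) := by
  refine zariskiClosure_eq_of_forall (Set.sep_subset _ _) fun f hf => ?_
  -- `f * p` vanishes on the whole image; its pullback lies in a domain, where the pullback of `p`
  -- is nonzero and cancels.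
  have h : aeval phiPoly (f * p) = 0 := aeval_phiPoly_eq_zero fun y hy => by
    rw [map_mul]
    by_cases h0 : eval y p = 0
    · rw [h0, mul_zero]
    · rw [hf y ⟨hy, h0⟩, zero_mul]
  rw [map_mul] at h
  have hf0 := (mul_eq_zero.1 h).resolve_right (aeval_phiPoly_ne_zero hp)
  rintro _ ⟨x', rfl⟩
  rw [phi_eq_phiFun, ← eval_phiPoly, ← eval_aeval, hf0, map_zero]

/-! ### The image of `φ` is semialgebraic -/

/-- Cramer's criterion eliminates the quantifier over `A`, leaving a finite union over minors of
explicit polynomial conditions. -/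
theorem isSemialgebraic_range_phi :
    IsSemialgebraic (Set.range (phi (d := d) (n := n) (m := m))) := by
  let E {r : ℕ} (I : Fin r → Fin m ⊕ Fin m) (J : Fin r → Fin n) :
      Matrix (Fin m ⊕ Fin m) (Fin d) (MvPolynomial (CandIdx d n m) ℝ) :=
    (polyST d n m).submatrix id J *
      (((polyST d n m).submatrix I J).adjugate * (polyVW d n m).submatrix I id) -
    ((polyST d n m).submatrix I J).det • polyVW d n m
  have hE : ∀ {r : ℕ} (I : Fin r → Fin m ⊕ Fin m) (J : Fin r → Fin n) (y : CandIdx d n m → ℝ),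
      (E I J).map (eval y) = (candST y).submatrix id J *
        (((candST y).submatrix I J).adjugate * (candVW y).submatrix I id) -
          ((candST y).submatrix I J).det • candVW y := fun I J y => by
    have h1 : ((polyST d n m).submatrix I J).adjugate.map (eval y) =
        ((candST y).submatrix I J).adjugate := by
      have := RingHom.map_adjugate (eval y) ((polyST d n m).submatrix I J)
      rw [RingHom.mapMatrix_apply, RingHom.mapMatrix_apply, ← Matrix.submatrix_map,
        polyST_map] at this
      exact this
    have h2 : (((polyST d n m).submatrix I J).det • polyVW d n m).map (eval y) =
        ((candST y).submatrix I J).det • candVW y := by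
      rw [← eval_det_submatrix, ← polyVW_map]
      ext i j
      simp
    simp only [E]
    rw [Matrix.map_sub _ (map_sub (eval y)), Matrix.map_mul, Matrix.map_mul, h1, h2,
      ← Matrix.submatrix_map, ← Matrix.submatrix_map, polyST_map, polyVW_map]
  have hset : Set.range (phi (d := d) (n := n) (m := m)) =
      (⋂ k, ⋂ i, {y | 0 ≤ eval y (polyST d n m k i)}) ∩
      ⋃ r : Fin (Fintype.card (Fin n) + 1), ⋃ I : Fin r → Fin m ⊕ Fin m, ⋃ J : Fin r → Fin n,
        {y | eval y ((polyST d n m).submatrix I J).det = 0}ᶜ ∩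
        ⋂ k, ⋂ j, {y | eval y (E I J k j) = 0} := by
    ext y
    rw [mem_range_phi_iff, exists_mul_eq_iff, Set.mem_inter_iff]
    refine and_congr ?_ ?_
    · simp only [Set.mem_iInter, Set.mem_ofPred_eq, ← polyST_map, Matrix.map_apply]
    · simp only [Set.mem_iUnion, Set.mem_inter_iff, Set.mem_compl_iff, Set.mem_ofPred_eq,
        Set.mem_iInter, eval_det_submatrix, ← hE, ← Matrix.ext_iff, Matrix.map_apply,
        Matrix.zero_apply, ne_eq]
  rw [hset]
  refine .inter (.iInter fun _ => .iInter fun _ => .nonneg _) ?_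
  exact .iUnion fun _ => .iUnion fun _ => .iUnion fun _ =>
    (IsSemialgebraic.eq_zero _).compl.inter (.iInter fun _ => .iInter fun _ => .eq_zero _)

/-! ### Generic fibers -/

theorem expectedDim_of_le (h : 2 * m ≤ n) : expectedDim d n m = (n - 2 * m) * d := by
  obtain ⟨k, rfl⟩ := Nat.exists_eq_add_of_le h
  have : (d : ℤ) * ((2 * m + k : ℕ) : ℤ) - 2 * d * m = ((k * d : ℕ) : ℤ) := by
    push_cast
    ring
  rw [expectedDim, this, Nat.add_sub_cancel_left, max_eq_right (Int.natCast_nonneg _),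
    Int.toNat_natCast]

theorem expectedDim_of_ge (h : n ≤ 2 * m) : expectedDim d n m = 0 := by
  have h1 : (d : ℤ) * n ≤ d * ((2 * m : ℕ) : ℤ) :=
    mul_le_mul_of_nonneg_left (by exact_mod_cast h) (Int.natCast_nonneg _)
  have h2 : (d : ℤ) * n - 2 * d * m ≤ 0 := by
    push_cast at h1
    linarith
  rw [expectedDim, max_eq_left h2, Int.toNat_zero]

/-- A splitting of the `n` indices that singles out `2m` of them. -/
theorem nonempty_sumEquiv (h : 2 * m ≤ n) :
    Nonempty ((Fin m ⊕ Fin m) ⊕ Fin (n - 2 * m) ≃ Fin n) :=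
  ⟨Fintype.equivOfCardEq (by simp; omega)⟩

theorem nonempty_rowEmbedding (h : n ≤ 2 * m) : Nonempty (Fin n ↪ Fin m ⊕ Fin m) :=
  Function.Embedding.nonempty_of_card_le (by simp; omega)

/-- There are weights for which `u` has entries `1` and a given minor of `(s, t)` is nonzero. -/
theorem exists_minor_ne_zero {r : Type} [Fintype r] [DecidableEq r] (I : r → Fin m ⊕ Fin m)
    (hI : I.Injective) (J : r → Fin n) (hJ : J.Injective) :
    ∃ x : WeightIdx d n m → ℝ, (∀ j i, candU (phiFun x) j i = 1) ∧
      ((candST (phiFun x)).submatrix I J).det ≠ 0 := by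
  classical
  refine ⟨mkWeights 0 (Matrix.of fun _ _ => 1)
    (Matrix.of fun k i => if ∃ l, I l = k ∧ J l = i then 1 else 0), fun j i => ?_, ?_⟩
  · simp [candU_phiFun]
  · have : (Matrix.of fun (k : Fin m ⊕ Fin m) (i : Fin n) =>
        if ∃ l, I l = k ∧ J l = i then (1 : ℝ) else 0).submatrix I J = 1 := by
      ext a b
      simp only [Matrix.submatrix_apply, Matrix.of_apply, Matrix.one_apply]
      refine if_congr ⟨?_, ?_⟩ rfl rfl
      · rintro ⟨l, h1, h2⟩
        exact (hI h1).symm.trans (hJ h2)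
      · rintro rfl
        exact ⟨a, rfl, rfl⟩
    rw [candST_phiFun, weightCD_mkWeights, this, Matrix.det_one]
    exact one_ne_zero

/-- A polynomial parametrization of the solutions of `M * A = V`, with `M` and `V` the matrices of
`y`, such that the parameters are entries of `A`. -/
structure FiberParam (y : CandIdx d n m → ℝ) (κ : Type) where
  sol : Matrix (Fin n) (Fin d) (MvPolynomial κ ℝ)
  entry : κ → Fin n × Fin d
  mul_sol : ∀ a, candST y * sol.map (eval a) = candVW y
  eval_entry : ∀ a k, eval a (sol (entry k).1 (entry k).2) = a k
  eq_sol : ∀ A, candST y * A = candVW y → ∃ a, A = sol.map (eval a)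

/-- For generic `y` in the image of `φ`, the entries of `u` are nonzero and the fiber is
an affine space of the expected dimension. -/
theorem exists_generic_poly (d n m : ℕ) : ∃ (p : MvPolynomial (CandIdx d n m) ℝ) (κ : Type)
    (_ : Fintype κ), Fintype.card κ = expectedDim d n m ∧ (∃ x, eval (phiFun x) p ≠ 0) ∧
      ∀ y ∈ Set.range (phi (d := d) (n := n) (m := m)), eval y p ≠ 0 →
        (∀ j i, candU y j i ≠ 0) ∧ Nonempty (FiberParam y κ) := by
  -- This factor makes all entries of `u` nonzero, as the quotient fibers require; the other factor
  -- is a maximal minor of `(s, t)`.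
  let pu : MvPolynomial (CandIdx d n m) ℝ := ∏ j : Fin d, ∏ i : Fin n, X (.inl (j, i))
  have hpu : ∀ y, eval y pu = ∏ j, ∏ i, candU y j i := fun y => by
    simp [pu, candU]
  rcases le_total (2 * m) n with h | h
  · obtain ⟨e⟩ := nonempty_sumEquiv h
    refine ⟨pu * ((polyST d n m).submatrix id (e ∘ Sum.inl)).det, Fin (n - 2 * m) × Fin d,
      inferInstance, by simp [expectedDim_of_le h], ?_, ?_⟩
    · obtain ⟨x, hx1, hx2⟩ := exists_minor_ne_zero (d := d) id Function.injective_id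
        (e ∘ Sum.inl) (e.injective.comp Sum.inl_injective)
      refine ⟨x, ?_⟩
      rw [map_mul, hpu, eval_det_submatrix]
      simpa [hx1] using hx2
    · intro y hy hne
      rw [map_mul, hpu, eval_det_submatrix] at hne
      refine ⟨fun j i => ?_, ?_⟩
      · exact Finset.prod_ne_zero_iff.1 (Finset.prod_ne_zero_iff.1 (left_ne_zero_of_mul hne) j
          (Finset.mem_univ _)) i (Finset.mem_univ _)
      · obtain ⟨S, h1, h2, h3⟩ := exists_param_of_det_cols_ne_zero (candST y) (candVW y) e
          (right_ne_zero_of_mul hne)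
        exact ⟨⟨S, fun k => (e (.inr k.1), k.2), h1, h2, fun A hA => ⟨_, h3 A hA⟩⟩⟩
  · obtain ⟨e⟩ := nonempty_rowEmbedding h
    refine ⟨pu * ((polyST d n m).submatrix e id).det, Fin 0,
      inferInstance, by simp [expectedDim_of_ge h], ?_, ?_⟩
    · obtain ⟨x, hx1, hx2⟩ := exists_minor_ne_zero (d := d) e e.injective id
        Function.injective_id
      refine ⟨x, ?_⟩
      rw [map_mul, hpu, eval_det_submatrix]
      simpa [hx1] using hx2
    · intro y hy hne
      rw [map_mul, hpu, eval_det_submatrix] at hne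
      refine ⟨fun j i => ?_, ?_⟩
      · exact Finset.prod_ne_zero_iff.1 (Finset.prod_ne_zero_iff.1 (left_ne_zero_of_mul hne) j
          (Finset.mem_univ _)) i (Finset.mem_univ _)
      -- A solution exists only because `y` lies in the image; the invertible block of rows makes it
      -- unique, so there are no parameters.
      · obtain ⟨-, A₀, hA₀⟩ := mem_range_phi_iff.1 hy
        have hC : ∀ a : Fin 0 → ℝ, (A₀.map (C (σ := Fin 0))).map (eval a) = A₀ := fun a => by
          ext i j
          simp
        refine ⟨⟨A₀.map C, fun k => k.elim0, fun a => by rw [hC, hA₀], fun a k => k.elim0,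
          fun A hA => ⟨fun k => k.elim0, ?_⟩⟩⟩
        rw [hC]
        exact eq_of_det_rows_ne_zero (candST y) e (right_ne_zero_of_mul hne) (hA.trans hA₀.symm)

namespace FiberParam

variable {y : CandIdx d n m → ℝ} {κ : Type} (P : FiberParam y κ)

/-- The polynomial parametrization of the fiber over `y`. -/
noncomputable def weights : WeightIdx d n m → MvPolynomial κ ℝ :=
  mkWeights P.sol (P.sol + (candU y)ᵀ.map C) ((candST y).map C)

theorem eval_weights (a : κ → ℝ) : (fun e => eval a (P.weights e)) =
    mkWeights (P.sol.map (eval a)) (P.sol.map (eval a) + (candU y)ᵀ) (candST y) := by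
  funext e
  rcases e with (⟨i, j⟩ | ⟨i, j⟩) | (⟨k, i⟩ | ⟨k, i⟩) <;> simp [weights, mkWeights]

theorem eval_weights_mem (hy : y ∈ Set.range (phi (d := d) (n := n) (m := m))) (a : κ → ℝ) :
    (fun e => eval a (P.weights e)) ∈ weightSpace d n m := by
  rw [eval_weights, mem_weightSpace_iff, weightCD_mkWeights]
  exact (mem_range_phi_iff.1 hy).1

theorem phiFun_eval_weights (a : κ → ℝ) : phiFun (fun e => eval a (P.weights e)) = y := by
  rw [eval_weights, phiFun_eq_iff]
  simp [P.mul_sol]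

theorem image_fiber (hy : y ∈ Set.range (phi (d := d) (n := n) (m := m))) :
    Subtype.val '' (phi ⁻¹' {y} : Set (weightSpace d n m)) =
      Set.range fun (a : κ → ℝ) e => eval a (P.weights e) := by
  ext x
  constructor
  · rintro ⟨x, hx, rfl⟩
    have hx' : phiFun x.1 = y := by rw [← phi_eq_phiFun, hx]
    obtain ⟨h1, h2, h3⟩ := phiFun_eq_iff.1 hx'
    obtain ⟨a, ha⟩ := P.eq_sol _ h2
    refine ⟨a, ?_⟩
    change (fun e => eval a (P.weights e)) = x.1
    rw [eval_weights]
    refine weights_ext ?_ ?_ ?_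
    · rw [weightA_mkWeights, ha]
    · rw [weightB_mkWeights, h3, ha]
    · rw [weightCD_mkWeights, h1]
  · rintro ⟨a, rfl⟩
    exact ⟨⟨_, P.eval_weights_mem hy a⟩, (phi_eq_phiFun _).trans (P.phiFun_eval_weights a), rfl⟩

theorem eval_weights_entry (a : κ → ℝ) (k : κ) :
    weightA (fun e => eval a (P.weights e)) (P.entry k).1 (P.entry k).2 = a k := by
  rw [eval_weights, weightA_mkWeights]
  exact P.eval_entry a k

/-- The parametrization gives the upper bound. Its parameters are coordinates on the fiber, which
gives the lower bound. -/
theorem semialgDim_fiber [Fintype κ] (P : FiberParam y κ)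
    (hy : y ∈ Set.range (phi (d := d) (n := n) (m := m))) :
    semialgDim (Subtype.val '' (phi ⁻¹' {y} : Set (weightSpace d n m))) =
      (Fintype.card κ : WithBot ℕ∞) := by
  rw [P.image_fiber hy]
  refine le_antisymm ?_ ?_
  · refine semialgDim_le_card P.weights (Set.range_nonempty _) subset_rfl fun f hf => ?_
    refine MvPolynomial.funext fun a => ?_
    rw [eval_aeval, map_zero]
    exact hf _ ⟨a, rfl⟩
  · refine card_le_semialgDim (fun k => X (.inl (.inl (P.entry k)))) (fun _ => 1)
      (fun x _ k => by simp) fun q hq => ?_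
    refine MvPolynomial.funext fun a => ?_
    rw [map_zero, ← hq _ ⟨a, rfl⟩]
    congr 2
    funext k
    rw [eval_X, map_one, div_one]
    exact (P.eval_weights_entry a k).symm

end FiberParam

theorem isSemialgebraic_fiber (y : CandIdx d n m → ℝ) :
    IsSemialgebraic (Subtype.val '' (phi ⁻¹' {y} : Set (weightSpace d n m))) := by
  have : Subtype.val '' (phi ⁻¹' {y} : Set (weightSpace d n m)) =
      ((⋂ k : Fin m × Fin n, {x | 0 ≤ eval x (X (.inr (.inl k)) : MvPolynomial _ ℝ)}) ∩
        ⋂ k : Fin m × Fin n, {x | 0 ≤ eval x (X (.inr (.inr k)) : MvPolynomial _ ℝ)}) ∩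
      ⋂ e, {x | eval x (phiPoly e - C (y e)) = 0} := by
    ext x
    simp only [Set.mem_image, Set.mem_preimage, Set.mem_singleton_iff, Subtype.exists,
      exists_and_right, exists_eq_right, phi_eq_phiFun, Set.mem_inter_iff, Set.mem_iInter,
      Set.mem_ofPred_eq, eval_X, map_sub, eval_C, sub_eq_zero, exists_prop, Prod.forall]
    refine and_congr Iff.rfl ?_
    rw [← eval_phiPoly, funext_iff]
  rw [this]
  exact ((IsSemialgebraic.iInter fun _ => .nonneg _).inter (.iInter fun _ => .nonneg _)).inter
    (.iInter fun _ => .eq_zero _)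

/-- The fiber of `φ̄` over the class of `y` is the image of the fiber of `φ` over `y`. -/
theorem image_mk_fiber (y : CandIdx d n m → ℝ) :
    Quotient.mk (weightSetoid d n m) '' (phi ⁻¹' {y}) =
      phiBar ⁻¹' {Quotient.mk (candSetoid d n m) y} := by
  ext z
  constructor
  · rintro ⟨x, hx, rfl⟩
    rw [Set.mem_preimage, Set.mem_singleton_iff, ← (show phi x = y from hx)]
    rfl
  · obtain ⟨x, rfl⟩ := Quotient.exists_rep z
    intro hx
    have h : Quotient.mk (candSetoid d n m) (phi x) = Quotient.mk (candSetoid d n m) y := hx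
    obtain ⟨l, hl, hy⟩ := Quotient.exact h
    -- The scaling that takes `phi x` to `y` moves `x` into the fiber over `y` itself, by
    -- equivariance.
    have hmem : scaleWeights l x.1 ∈ weightSpace d n m :=
      ⟨fun k i => mul_nonneg (x.2.1 k i) (hl i).le, fun k i => mul_nonneg (x.2.2 k i) (hl i).le⟩
    refine ⟨⟨_, hmem⟩, ?_, Quotient.sound (Setoid.symm' _ ⟨l, hl, rfl⟩)⟩
    rw [Set.mem_preimage, Set.mem_singleton_iff, hy]
    exact phi_scale hl x ⟨_, hmem⟩ rfl

/-- A set of representatives of a generic fiber of `φ̄` has at least the dimension of the fiber. -/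
theorem FiberParam.card_le_semialgDim {y : CandIdx d n m → ℝ} {κ : Type} [Fintype κ]
    (P : FiberParam y κ) (hy : y ∈ Set.range (phi (d := d) (n := n) (m := m)))
    (hu : ∀ j i, candU y j i ≠ 0) {T : Set (weightSpace d n m)}
    (hT : Quotient.mk (weightSetoid d n m) '' T =
      phiBar ⁻¹' {Quotient.mk (candSetoid d n m) y}) :
    (Fintype.card κ : WithBot ℕ∞) ≤ semialgDim (Subtype.val '' T) := by
  rw [← image_mk_fiber] at hT
  -- The scaling factor cancels in `A / (B - A)`. Multiplied by the fixed entry of `u`, this ratio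
  -- at any representative `x` gives the entry of `A` at the equivalent point `x'` of the fiber.
  have hrel : ∀ x x' : weightSpace d n m, phi x' = y →
      Quotient.mk (weightSetoid d n m) x = Quotient.mk (weightSetoid d n m) x' → ∀ i j,
      weightB x.1 i j - weightA x.1 i j ≠ 0 ∧
      weightA x.1 i j * candU y j i / (weightB x.1 i j - weightA x.1 i j) = weightA x'.1 i j := by
    intro x x' hx' hxx' i j
    obtain ⟨l, hl, h⟩ := Quotient.exact hxx'
    have hA : weightA x'.1 i j = (l i)⁻¹ * weightA x.1 i j := by
      rw [h]
      rfl
    have hB : weightB x'.1 i j = (l i)⁻¹ * weightB x.1 i j := by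
      rw [h]
      rfl
    have hU : candU y j i = (l i)⁻¹ * (weightB x.1 i j - weightA x.1 i j) := by
      rw [← hx', phi_eq_phiFun, candU_phiFun, mul_sub, ← hA, ← hB]
      rfl
    have h0 : weightB x.1 i j - weightA x.1 i j ≠ 0 := fun h0 =>
      hu j i (by rw [hU, h0, mul_zero])
    refine ⟨h0, ?_⟩
    rw [hU, hA]
    field_simp
  refine Maxout.card_le_semialgDim
    (fun k => X (.inl (.inl (P.entry k))) * C (candU y (P.entry k).2 (P.entry k).1))
    (fun k => X (.inl (.inr (P.entry k))) - X (.inl (.inl (P.entry k)))) ?_ ?_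
  · rintro _ ⟨x, hx, rfl⟩ k
    obtain ⟨x', hx', hxx'⟩ := hT.subset ⟨x, hx, rfl⟩
    simpa [weightA, weightB] using (hrel x x' hx' hxx'.symm (P.entry k).1 (P.entry k).2).1
  · intro q hq
    refine MvPolynomial.funext fun a => ?_
    let x' : weightSpace d n m := ⟨_, P.eval_weights_mem hy a⟩
    have hx' : phi x' = y := (phi_eq_phiFun _).trans (P.phiFun_eval_weights a)
    obtain ⟨x, hx, hxx'⟩ := hT.superset ⟨x', hx', rfl⟩
    rw [map_zero, ← hq _ ⟨x, hx, rfl⟩]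
    congr 2
    funext k
    rw [← P.eval_weights_entry a k]
    rw [← (hrel x x' hx' hxx' (P.entry k).1 (P.entry k).2).2]
    simp [weightA, weightB]

/-- The fiber of `φ` is itself a semialgebraic set of representatives, and it attains the lower
bound. -/
theorem FiberParam.quotientDim_fiber {y : CandIdx d n m → ℝ} {κ : Type} [Fintype κ]
    (P : FiberParam y κ) (hy : y ∈ Set.range (phi (d := d) (n := n) (m := m)))
    (hu : ∀ j i, candU y j i ≠ 0) :
    quotientDim (Quotient.mk (weightSetoid d n m))
      (phiBar ⁻¹' {Quotient.mk (candSetoid d n m) y}) = (Fintype.card κ : WithBot ℕ∞) := by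
  refine le_antisymm ?_ (le_iInf fun T => le_iInf₂ fun _ hT => P.card_le_semialgDim hy hu hT)
  rw [← P.semialgDim_fiber hy]
  exact iInf_le_of_le _ (iInf₂_le (isSemialgebraic_fiber y) (image_mk_fiber y))

/-! ### The Zariski closure of the image -/

theorem phiFun_mem_zariskiClosure (x : WeightIdx d n m → ℝ) :
    phiFun x ∈ zariskiClosure (Set.range (phi (d := d) (n := n) (m := m))) :=
  mem_zariskiClosure_iff.2 fun _ hf => eval_phiFun_eq_zero hf x

theorem candMatrix_eq (y : CandIdx d n m → ℝ) :
    candMatrix y = Matrix.fromRows (candST y)ᵀ (candVW y)ᵀ := by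
  ext (i | j) (k | k) <;> rfl

theorem candMatrix_phiFun (x : WeightIdx d n m → ℝ) :
    candMatrix (phiFun x) =
      Matrix.fromRows (1 : Matrix (Fin n) (Fin n) ℝ) (weightA x)ᵀ * (weightCD x)ᵀ := by
  rw [candMatrix_eq, candST_phiFun, candVW_phiFun, Matrix.fromRows_mul, Matrix.one_mul,
    Matrix.transpose_mul]

/-- A nonzero minor of size greater than `n` would be a polynomial that vanishes on the image, where
`candMatrix` factors through dimension `n`, but not at `y`. -/
theorem zariskiClosure_range_subset :
    zariskiClosure (Set.range (phi (d := d) (n := n) (m := m))) ⊆ detVariety d n m := by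
  intro y hy
  by_contra hrank
  obtain ⟨I, J, hdet, -⟩ := exists_minor (candMatrix y)
  have hlt : n < (candMatrix y).rank := not_le.1 hrank
  let G : Matrix (Fin n ⊕ Fin d) (Fin m ⊕ Fin m) (MvPolynomial (CandIdx d n m) ℝ) :=
    Matrix.fromRows (polyST d n m)ᵀ (polyVW d n m)ᵀ
  have hG : ∀ y', G.map (eval y') = candMatrix y' := fun y' => by
    rw [candMatrix_eq, ← polyST_map, ← polyVW_map]
    ext (i | j) k <;> rfl
  have hev : ∀ y', eval y' (G.submatrix I J).det = ((candMatrix y').submatrix I J).det :=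
    fun y' => by rw [eval_det, ← Matrix.submatrix_map, hG]
  refine hdet ?_
  rw [← hev]
  refine hy _ ?_
  rintro _ ⟨x, rfl⟩
  change eval _ _ = 0
  rw [hev, phi_eq_phiFun, candMatrix_phiFun]
  exact det_submatrix_mul_eq_zero _ _ hlt I J

/-- Factor `candMatrix y` as `P * Q` with blocks `P₁`, `P₂` of `P`. If `P₁` is invertible, then `A =
(P₂ * P₁⁻¹)ᵀ` solves the system. In general `P₁` is replaced by `P₁ + ε`, which changes only `s` and
`t`, and `ε` tends to `0`. -/
theorem detVariety_subset_zariskiClosure :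
    detVariety d n m ⊆ zariskiClosure (Set.range (phi (d := d) (n := n) (m := m))) := by
  intro y hy
  obtain ⟨P, Q, hPQ⟩ := exists_eq_mul_of_rank_le (candMatrix y) hy
  let P₁ : Matrix (Fin n) (Fin n) ℝ := P.submatrix Sum.inl id
  let P₂ : Matrix (Fin d) (Fin n) ℝ := P.submatrix Sum.inr id
  have h₁ : (candST y)ᵀ = P₁ * Q := by
    have := congrArg (fun W => W.submatrix Sum.inl id) (candMatrix_eq y)
    exact this.symm.trans (congrArg (fun W => W.submatrix Sum.inl id) hPQ)
  have h₂ : (candVW y)ᵀ = P₂ * Q := by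
    have := congrArg (fun W => W.submatrix Sum.inr id) (candMatrix_eq y)
    exact this.symm.trans (congrArg (fun W => W.submatrix Sum.inr id) hPQ)
  let L : ℝ → Matrix (Fin n) (Fin n) ℝ := fun ε => Matrix.scalar (Fin n) ε + P₁
  let g : ℝ → CandIdx d n m → ℝ := fun ε e => match e with
    | .inl k => y (.inl k)
    | .inr (.inl k) => y (.inr (.inl k))
    | .inr (.inr (.inl (k, i))) => (L ε * Q) i (.inl k)
    | .inr (.inr (.inr (k, i))) => (L ε * Q) i (.inr k)
  have hgST : ∀ ε, candST (g ε) = (L ε * Q)ᵀ := fun ε => by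
    ext (k | k) i <;> rfl
  have hgVW : ∀ ε, candVW (g ε) = candVW y := fun ε => rfl
  have hgU : ∀ ε, candU (g ε) = candU y := fun ε => rfl
  have hg0 : g 0 = y := by
    refine cand_ext (hgU 0) (hgVW 0) ?_
    rw [hgST, show L 0 = P₁ by simp [L], ← h₁, Matrix.transpose_transpose]
  have hLcont : ∀ i j, Continuous fun ε => L ε i j := fun i j => by
    simp only [L, Matrix.add_apply, Matrix.scalar_apply, Matrix.diagonal_apply]
    split_ifs <;> fun_prop
  have hLQ : ∀ i k, Continuous fun ε => (L ε * Q) i k := fun i k => by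
    simp only [Matrix.mul_apply]
    exact continuous_finsetSum _ fun l _ => (hLcont i l).mul continuous_const
  have hgcont : Continuous g := by
    refine continuous_pi fun e => ?_
    rcases e with k | k | ⟨k, i⟩ | ⟨k, i⟩
    · exact continuous_const
    · exact continuous_const
    · exact hLQ i (.inl k)
    · exact hLQ i (.inr k)
  have hmem : ∀ ε, (L ε).det ≠ 0 →
      g ε ∈ zariskiClosure (Set.range (phi (d := d) (n := n) (m := m))) := fun ε hε => by
    let A : Matrix (Fin n) (Fin d) ℝ := (P₂ * (L ε)⁻¹)ᵀ
    have hx : phiFun (mkWeights A (A + (candU y)ᵀ) (L ε * Q)ᵀ) = g ε := by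
      rw [phiFun_eq_iff, hgST, hgVW, hgU]
      refine ⟨weightCD_mkWeights _ _ _, ?_, rfl⟩
      rw [weightA_mkWeights, ← Matrix.transpose_mul, Matrix.mul_assoc,
        Matrix.nonsing_inv_mul_cancel_left _ _ hε.isUnit, ← h₂, Matrix.transpose_transpose]
    rw [← hx]
    exact phiFun_mem_zariskiClosure _
  have hdense : Dense {ε : ℝ | (L ε).det ≠ 0} := by
    have hfin : {ε : ℝ | (L ε).det = 0}.Finite := by
      -- `det (ε + P₁)` is the characteristic polynomial of `-P₁` at `ε`, so it vanishes for
      -- finitely many `ε`.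
      refine ((-P₁).charpoly.roots.toFinset.finite_toSet).subset fun ε hε => ?_
      rw [Finset.mem_coe, Multiset.mem_toFinset,
        Polynomial.mem_roots (Matrix.charpoly_monic _).ne_zero, Polynomial.IsRoot,
        Matrix.eval_charpoly, sub_neg_eq_add]
      exact hε
    exact hfin.countable.dense_compl ℝ
  rw [← hg0]
  have := map_mem_closure hgcont (hdense 0) (t := zariskiClosure _) hmem
  rwa [(isClosed_zariskiClosure _).closure_eq] at this

theorem zariskiClosure_range_phi :
    zariskiClosure (Set.range (phi (d := d) (n := n) (m := m))) = detVariety d n m :=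
  zariskiClosure_range_subset.antisymm detVariety_subset_zariskiClosure

/-! ### The dimension of the image -/

theorem range_phi_nonempty : (Set.range (phi (d := d) (n := n) (m := m))).Nonempty :=
  ⟨_, ⟨0, fun _ _ => le_rfl, fun _ _ => le_rfl⟩, rfl⟩

theorem card_weightIdx (d n m : ℕ) : Fintype.card (WeightIdx d n m) = 2 * n * d + 2 * m * n := by
  simp only [Fintype.card_sum, Fintype.card_prod, Fintype.card_fin]
  ring

theorem card_candIdx (d n m : ℕ) : Fintype.card (CandIdx d n m) = d * n + 2 * m * (d + n) := by
  simp only [Fintype.card_sum, Fintype.card_prod, Fintype.card_fin]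
  ring

theorem semialgDim_range_le : semialgDim (Set.range (phi (d := d) (n := n) (m := m))) ≤
    (Fintype.card (WeightIdx d n m) : WithBot ℕ∞) := by
  refine semialgDim_le_card phiPoly range_phi_nonempty ?_ fun f hf => aeval_phiPoly_eq_zero hf
  rintro _ ⟨x, rfl⟩
  exact ⟨x.1, (eval_phiPoly _).trans (phi_eq_phiFun x).symm⟩

/-- If `n ≤ 2m`, the weights are rational functions on a dense open subset of the image. -/
theorem card_le_semialgDim_range (h : n ≤ 2 * m) : (Fintype.card (WeightIdx d n m) : WithBot ℕ∞) ≤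
    semialgDim (Set.range (phi (d := d) (n := n) (m := m))) := by
  obtain ⟨e⟩ := nonempty_rowEmbedding h
  let N := (polyST d n m).submatrix e id
  -- Cramer's numerators: on the range of `phiFun`, `W` equals `det N` times `A`.
  let W : Matrix (Fin n) (Fin d) (MvPolynomial (CandIdx d n m) ℝ) :=
    N.adjugate * (polyVW d n m).submatrix e id
  have hN : ∀ y, eval y N.det = ((candST y).submatrix e id).det := eval_det_submatrix e id
  have hW : ∀ x i j, eval (phiFun x) (W i j) = eval (phiFun x) N.det * weightA x i j := by
    intro x i j
    have h1 : N.map (eval (phiFun x)) = (weightCD x).submatrix e id := by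
      rw [← candST_phiFun, ← polyST_map]
      rfl
    have h2 : W.map (eval (phiFun x)) = eval (phiFun x) N.det • weightA x := by
      have h3 := RingHom.map_adjugate (eval (phiFun x)) N
      rw [RingHom.mapMatrix_apply, RingHom.mapMatrix_apply, h1] at h3
      have h4 : (weightCD x * weightA x).submatrix e id =
        (weightCD x).submatrix e id * weightA x := rfl
      rw [Matrix.map_mul, h3, ← Matrix.submatrix_map, polyVW_map, candVW_phiFun, h4,
        ← Matrix.mul_assoc, Matrix.adjugate_mul, Matrix.smul_mul, Matrix.one_mul, hN,
        candST_phiFun]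
    exact congrFun (congrFun h2 i) j
  obtain ⟨x₀, -, hx₀⟩ := exists_minor_ne_zero (d := d) e e.injective id Function.injective_id
  have hx₀' : eval (phiFun x₀) N.det ≠ 0 := by rwa [hN]
  -- Passing to the dense part of the image where `det N` is nonzero keeps the dimension and removes
  -- the poles.
  rw [← semialgDim_zariskiClosure, ← zariskiClosure_ne_zero hx₀', semialgDim_zariskiClosure]
  let a : WeightIdx d n m → MvPolynomial (CandIdx d n m) ℝ := mkWeights W
    (Matrix.of fun i j => W i j + X (.inl (j, i)) * N.det) (N.det • polyST d n m)
  have ha : ∀ x, eval (phiFun x) N.det ≠ 0 →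
      (fun k => eval (phiFun x) (a k) / eval (phiFun x) N.det) = x := fun x hx => by
    funext k
    rw [div_eq_iff hx]
    rcases k with (⟨i, j⟩ | ⟨i, j⟩) | (⟨k, i⟩ | ⟨k, i⟩)
    · simp only [a, mkWeights, hW, weightA, Matrix.of_apply]
      ring
    · simp only [a, mkWeights, hW, weightA, weightB, Matrix.of_apply, map_add, map_mul, eval_X,
        phiFun, Matrix.transpose_apply, Matrix.sub_apply]
      ring
    · simp only [a, mkWeights, Matrix.smul_apply, polyST, Matrix.fromRows_apply_inl, smul_eq_mul,
        Matrix.of_apply, map_mul, eval_X, phiFun, weightC]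
      ring
    · simp only [a, mkWeights, Matrix.smul_apply, polyST, Matrix.fromRows_apply_inr, smul_eq_mul,
        Matrix.of_apply, map_mul, eval_X, phiFun, weightD]
      ring
  refine card_le_semialgDim a (fun _ => N.det) (fun y hy _ => hy.2) fun q hq => ?_
  have hprod : q * aeval phiPoly N.det = 0 := eq_zero_of_weightSpace fun x hx => by
    rw [map_mul, eval_aeval, eval_phiPoly]
    by_cases h0 : eval (phiFun x) N.det = 0
    · rw [h0, mul_zero]
    · have := hq (phiFun x) ⟨⟨⟨x, hx⟩, phi_eq_phiFun _⟩, h0⟩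
      rw [ha x h0] at this
      rw [this, zero_mul]
  exact (mul_eq_zero.1 hprod).resolve_right (aeval_phiPoly_ne_zero hx₀')

theorem semialgDim_range_of_le (h : n ≤ 2 * m) :
    semialgDim (Set.range (phi (d := d) (n := n) (m := m))) =
      ((2 * n * d + 2 * m * n : ℕ) : WithBot ℕ∞) := by
  rw [← card_weightIdx]
  exact le_antisymm semialgDim_range_le (card_le_semialgDim_range h)

/-- Dimension count: the target has `2dm - dn > 0` more coordinates than the weights. -/
theorem zariskiClosure_range_ne_univ (h : (d : ℤ) * n - 2 * d * m < 0) :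
    zariskiClosure (Set.range (phi (d := d) (n := n) (m := m))) ≠ Set.univ := by
  intro huniv
  have hle := semialgDim_range_le (d := d) (n := n) (m := m)
  rw [← semialgDim_zariskiClosure, huniv, semialgDim_univ, card_weightIdx, card_candIdx] at hle
  have h1 : d * n + 2 * m * (d + n) ≤ 2 * n * d + 2 * m * n := by exact_mod_cast hle
  zify at h1
  nlinarith

/-! ### Full-dimensional images -/

/-- If `2m` columns of `(s, t)` form an invertible matrix, the system is solvable for every
right-hand side. Hence the open positive orthant minus a hypersurface lies in the image. -/
theorem interior_range_phi_nonempty (h : 2 * m ≤ n) :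
    (interior (Set.range (phi (d := d) (n := n) (m := m)))).Nonempty := by
  obtain ⟨e⟩ := nonempty_sumEquiv h
  let p := ((polyST d n m).submatrix id (e ∘ Sum.inl)).det
  let U₁ : Set (CandIdx d n m → ℝ) := {y | ∀ k, 0 < y k}
  have hU₁ : IsOpen U₁ := by
    have : U₁ = ⋂ k, {y | 0 < y k} := by
      ext y
      simp [U₁]
    rw [this]
    exact isOpen_iInter_of_finite fun k => isOpen_lt continuous_const (continuous_apply k)
  have hU₂ : IsOpen {y : CandIdx d n m → ℝ | eval y p ≠ 0} :=
    isOpen_ne_fun (continuous_eval p) continuous_const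
  have hsub : U₁ ∩ {y | eval y p ≠ 0} ⊆ Set.range (phi (d := d) (n := n) (m := m)) := by
    rintro y ⟨hy, hp⟩
    rw [mem_range_phi_iff]
    constructor
    · rintro (k | k) i
      · exact (hy (.inr (.inr (.inl (k, i))))).le
      · exact (hy (.inr (.inr (.inr (k, i))))).le
    · have hdet : ((candST y).submatrix id (e ∘ Sum.inl)).det ≠ 0 := by
        rw [← eval_det_submatrix]
        exact hp
      obtain ⟨S, hS, -⟩ := exists_param_of_det_cols_ne_zero (candST y) (candVW y) e hdet
      exact ⟨_, hS 0⟩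
  obtain ⟨x₀, -, hx₀⟩ := exists_minor_ne_zero (d := d) id Function.injective_id
    (e ∘ Sum.inl) (e.injective.comp Sum.inl_injective)
  obtain ⟨y, hy, hp⟩ : ∃ y ∈ U₁, eval y p ≠ 0 := by
    by_contra! hall
    have h0 : p = 0 := eq_zero_of_isOpen hU₁ ⟨fun _ => 1, fun _ => one_pos⟩ hall
    rw [← eval_det_submatrix] at hx₀
    exact hx₀ (by rw [show ((polyST d n m).submatrix id (e ∘ Sum.inl)).det = 0 from h0, map_zero])
  exact ⟨y, interior_maximal hsub (hU₁.inter hU₂) ⟨hy, hp⟩⟩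

theorem zariskiClosure_range_eq_univ (h : 2 * m ≤ n) :
    zariskiClosure (Set.range (phi (d := d) (n := n) (m := m))) = Set.univ := by
  refine Set.eq_univ_of_forall fun y => mem_zariskiClosure_iff.2 fun f hf => ?_
  rw [eq_zero_of_isOpen isOpen_interior (interior_range_phi_nonempty h)
    fun x hx => hf x (interior_subset hx), map_zero]

theorem semialgDim_range_of_ge (h : 2 * m ≤ n) :
    semialgDim (Set.range (phi (d := d) (n := n) (m := m))) =
      ((d * n + 2 * m * (d + n) : ℕ) : WithBot ℕ∞) := by
  rw [← semialgDim_zariskiClosure, zariskiClosure_range_eq_univ h, semialgDim_univ, card_candIdx]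

end Maxout

open Maxout in
theorem mainTheorem3 (d n m : ℕ) :
    -- generic fibers of `φ` and of the induced map on the quotients
    (∃ p : MvPolynomial (CandIdx d n m) ℝ,
      zariskiClosure {y ∈ Set.range (phi (d := d) (n := n) (m := m)) | MvPolynomial.eval y p ≠ 0} =
        zariskiClosure (Set.range (phi (d := d) (n := n) (m := m))) ∧
      ∀ y ∈ Set.range (phi (d := d) (n := n) (m := m)), MvPolynomial.eval y p ≠ 0 →
        semialgDim (Subtype.val '' (phi ⁻¹' {y} : Set (weightSpace d n m))) =
          (expectedDim d n m : WithBot ℕ∞) ∧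
        quotientDim (Quotient.mk (weightSetoid d n m))
            (phiBar ⁻¹' {Quotient.mk (candSetoid d n m) y}) =
          (expectedDim d n m : WithBot ℕ∞)) ∧
    -- the image of `φ`
    IsSemialgebraic (Set.range (phi (d := d) (n := n) (m := m))) ∧
    (n ≤ 2 * m →
      zariskiClosure (Set.range (phi (d := d) (n := n) (m := m))) = detVariety d n m ∧
      semialgDim (detVariety d n m) = ((2 * n * d + 2 * m * n : ℕ) : WithBot ℕ∞) ∧
      semialgDim (Set.range (phi (d := d) (n := n) (m := m))) =
        ((2 * n * d + 2 * m * n : ℕ) : WithBot ℕ∞)) ∧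
    ((d : ℤ) * n - 2 * d * m < 0 →
      zariskiClosure (Set.range (phi (d := d) (n := n) (m := m))) ≠ Set.univ) ∧
    (2 * m ≤ n →
      zariskiClosure (Set.range (phi (d := d) (n := n) (m := m))) = Set.univ ∧
      semialgDim (Set.range (phi (d := d) (n := n) (m := m))) =
        ((d * n + 2 * m * (d + n) : ℕ) : WithBot ℕ∞) ∧
      (interior (Set.range (phi (d := d) (n := n) (m := m)))).Nonempty) := by
  refine ⟨?_, isSemialgebraic_range_phi, fun h => ⟨zariskiClosure_range_phi, ?_,
    semialgDim_range_of_le h⟩, zariskiClosure_range_ne_univ, fun h =>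
    ⟨zariskiClosure_range_eq_univ h, semialgDim_range_of_ge h, interior_range_phi_nonempty h⟩⟩
  · obtain ⟨p, κ, _, hcard, ⟨x, hx⟩, hp⟩ := exists_generic_poly d n m
    refine ⟨p, zariskiClosure_ne_zero hx, fun y hy hne => ?_⟩
    obtain ⟨hu, ⟨P⟩⟩ := hp y hy hne
    rw [← hcard]
    exact ⟨P.semialgDim_fiber hy, P.quotientDim_fiber hy hu⟩
  · rw [← zariskiClosure_range_phi, semialgDim_zariskiClosure, semialgDim_range_of_le h]
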